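/- Let $\mathbb{T}^2=\mathbb{R}^2/\mathbb{Z}^2\subset\mathbb{C}^2/\mathbb{Z}^2$. Let $\mathrm{Ham}^\omega(\mathbb{T}^2)$ be the set of all finite compositions of time-one maps of Hamiltonian flows on $\mathbb{T}^2$ (with respect to the area form $dx\wedge dy$) generated by real-analytic time-dependent Hamiltonian functions $H:\mathbb{R}\times\mathbb{T}^2\to\mathbb{R}$. For an open neighborhood $U$ of $\mathbb{T}^2$ in $\mathbb{C}^2/\mathbb{Z}^2$, let $\mathrm{Ham}^\omega_U(\mathbb{T}^2)$ be the set of holomorphic maps $U\to\mathbb{C}^2/\mathbb{Z}^2$ whose restriction to $\mathbb{T}^2$ is an element of $\mathrm{Ham}^\omega(\mathbb{T}^2)$ (that is, elements of $\mathrm{Ham}^\omega(\mathbb{T}^2)$ together with a holomorphic extension to $U$), with the topology of uniform convergence on compact subsets of $U$. For $n\ge 1$, let $\mathcal{ND}_n$ be the set of $f\in\mathrm{Ham}^\omega(\mathbb{T}^2)$ such that, for every $1\le k\le n$ and every $x\in\mathbb{T}^2$ with $f^k(x)=x$ (where $k$ need not be the least period of $x$), the derivative $D(f^k)_x$ is hyperbolic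 (it has no eigenvalue of modulus $1$) or elliptic (its eigenvalues are non-real and of modulus $1$). Let $U$ be an open neighborhood of $\mathbb{T}^2$ in $\mathbb{C}^2/\mathbb{Z}^2$ whose closure is compact. Then, for every $n\ge 1$, the subset $\mathcal{ND}_n\cap\mathrm{Ham}^\omega_U(\mathbb{T}^2)$, consisting of those elements of $\mathrm{Ham}^\omega_U(\mathbb{T}^2)$ whose restriction to $\mathbb{T}^2$ belongs to $\mathcal{ND}_n$, is open and dense in $\mathrm{Ham}^\omega_U(\mathbb{T}^2)$. -/

import Mathlib

open Set Filter Topology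

noncomputable section

/-- The real torus `𝕋² = ℝ²/ℤ²`. -/
abbrev RealTorus : Type := AddCircle (1 : ℝ) × AddCircle (1 : ℝ)

/-- The complexified torus `ℂ²/ℤ²`. -/
abbrev ComplexTorus : Type := AddCircle (1 : ℂ) × AddCircle (1 : ℂ)

/-- The projection `ℝ² → ℝ²/ℤ²`. -/
def realProj (p : ℝ × ℝ) : RealTorus := ((p.1 : AddCircle (1 : ℝ)), (p.2 : AddCircle (1 : ℝ)))

/-- The projection `ℂ² → ℂ²/ℤ²`. -/
def complexProj (z : ℂ × ℂ) : ComplexTorus :=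
  ((z.1 : AddCircle (1 : ℂ)), (z.2 : AddCircle (1 : ℂ)))

/-- The inclusion `ℝ/ℤ → ℂ/ℤ` induced by `ℝ ⊆ ℂ`. -/
def circleIncl : AddCircle (1 : ℝ) →+ AddCircle (1 : ℂ) :=
  QuotientAddGroup.map _ _ Complex.ofRealHom.toAddMonoidHom (by
    rw [AddSubgroup.zmultiples_le]
    exact ⟨1, by simp⟩)

/-- The inclusion `𝕋² = ℝ²/ℤ² → ℂ²/ℤ²` induced by `ℝ² ⊆ ℂ²`. -/
def torusIncl (x : RealTorus) : ComplexTorus := (circleIncl x.1, circleIncl x.2)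

/-- `X_H(t, ·) = (∂H/∂y, -∂H/∂x)`, the Hamiltonian vector field of `H(t, ·)` with respect to
`dx ∧ dy`, as a `ℤ²`-periodic vector field on `ℝ²`. -/
def hamVectorField (H : ℝ → RealTorus → ℝ) (t : ℝ) (p : ℝ × ℝ) : ℝ × ℝ :=
  (deriv (fun y : ℝ => H t (realProj (p.1, y))) p.2,
    -deriv (fun x : ℝ => H t (realProj (x, p.2))) p.1)

/-- `f` is the time-one map of the Hamiltonian flow of a time-dependent Hamiltonian
`H : ℝ × 𝕋² → ℝ` which is real-analytic (in all variables). The flow is given by its lift `φ` to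
the universal cover `ℝ²`: `t ↦ φ t p` is the solution of `p' = X_H(t, p)` starting at `p` at
time `0`. -/
def IsHamTimeOneMap (f : RealTorus → RealTorus) : Prop :=
  ∃ (H : ℝ → RealTorus → ℝ) (φ : ℝ → ℝ × ℝ → ℝ × ℝ),
    AnalyticOnNhd ℝ (fun q : ℝ × (ℝ × ℝ) => H q.1 (realProj q.2)) univ ∧
    (∀ p, φ 0 p = p) ∧
    (∀ p t, HasDerivAt (fun s => φ s p) (hamVectorField H t (φ t p)) t) ∧
    (∀ p, f (realProj p) = realProj (φ 1 p))

/-- Membership in `Ham^ω(𝕋²)`: finite compositions of time-one maps of Hamiltonian flows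
associated with real-analytic time-dependent Hamiltonians. -/
inductive IsHamDiffeo : (RealTorus → RealTorus) → Prop
  | timeOne {f : RealTorus → RealTorus} (hf : IsHamTimeOneMap f) : IsHamDiffeo f
  | comp {f g : RealTorus → RealTorus} (hf : IsHamDiffeo f) (hg : IsHamDiffeo g) :
      IsHamDiffeo (f ∘ g)

/-- `A` is the derivative at `x` of the self-map `f` of `𝕋²`, computed in the charts given by
local inverses of `ℝ² → 𝕋²` (so that all tangent spaces are identified with `ℝ²`). -/
def HasTorusDerivAt (f : RealTorus → RealTorus) (A : ℝ × ℝ →L[ℝ] ℝ × ℝ) (x : RealTorus) : Prop :=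
  ∃ (p : ℝ × ℝ) (g : ℝ × ℝ → ℝ × ℝ), realProj p = x ∧
    (∀ᶠ q in 𝓝 p, realProj (g q) = f (realProj q)) ∧ HasFDerivAt g A p

/-- `μ ∈ ℂ` is a (complex) eigenvalue of the real linear map `A`. -/
def IsComplexEigenvalue (A : ℝ × ℝ →L[ℝ] ℝ × ℝ) (μ : ℂ) : Prop :=
  Polynomial.aeval μ (LinearMap.charpoly (A : ℝ × ℝ →ₗ[ℝ] ℝ × ℝ)) = 0

/-- No eigenvalue lies on the unit circle. -/
def IsHyperbolicMap (A : ℝ × ℝ →L[ℝ] ℝ × ℝ) : Prop :=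
  ∀ μ : ℂ, IsComplexEigenvalue A μ → ‖μ‖ ≠ 1

/-- The eigenvalues are non-real and lie on the unit circle. -/
def IsEllipticMap (A : ℝ × ℝ →L[ℝ] ℝ × ℝ) : Prop :=
  ∀ μ : ℂ, IsComplexEigenvalue A μ → ‖μ‖ = 1 ∧ μ.im ≠ 0

/-- The periodic point `x = f^k(x)` of period `k` is non-degenerate: it is hyperbolic or
elliptic. -/
def IsNonDegenerate (f : RealTorus → RealTorus) (k : ℕ) (x : RealTorus) : Prop :=
  ∃ A : ℝ × ℝ →L[ℝ] ℝ × ℝ, HasTorusDerivAt f^[k] A x ∧ (IsHyperbolicMap A ∨ IsEllipticMap A)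

/-- `𝒩𝒟ₙ`: the real-analytic Hamiltonian diffeomorphisms all of whose periodic points of period
at most `n` are non-degenerate. The period `k` need not be the least one. -/
def NDSet (n : ℕ) : Set (RealTorus → RealTorus) :=
  {f | IsHamDiffeo f ∧ ∀ k : ℕ, 1 ≤ k → k ≤ n → ∀ x, f^[k] x = x → IsNonDegenerate f k x}

/-- `F : U → ℂ²/ℤ²` is holomorphic: near each point, in the charts given by local inverses of
`ℂ² → ℂ²/ℤ²`, it is a holomorphic map between open subsets of `ℂ²`. -/
def IsHolomorphicOnTorus {U : Set ComplexTorus} (F : U → ComplexTorus) : Prop :=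
  ∀ z : ℂ × ℂ, complexProj z ∈ U → ∃ g : ℂ × ℂ → ℂ × ℂ, AnalyticAt ℂ g z ∧
    ∀ᶠ w in 𝓝 z, ∃ hw : complexProj w ∈ U, F ⟨complexProj w, hw⟩ = complexProj (g w)

/-- `F : U → ℂ²/ℤ²` extends the self-map `f` of `𝕋²`. -/
def Extends {U : Set ComplexTorus} (F : U → ComplexTorus) (f : RealTorus → RealTorus) : Prop :=
  ∀ (x : RealTorus) (hx : torusIncl x ∈ U), F ⟨torusIncl x, hx⟩ = torusIncl (f x)

/-- `Ham^ω_U(𝕋²)`, each map being identified with its holomorphic extension to `U`: the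
holomorphic maps `U → ℂ²/ℤ²` that extend a real-analytic Hamiltonian diffeomorphism of `𝕋²`.
As a subset of `C(U, ℂ²/ℤ²)` it carries the topology of uniform convergence on compact subsets
of `U` (the compact-open topology). -/
def HamU (U : Set ComplexTorus) : Set C(U, ComplexTorus) :=
  {F | IsHolomorphicOnTorus (F : U → ComplexTorus) ∧ ∃ f, IsHamDiffeo f ∧ Extends F f}

/-- `𝒩𝒟ₙ ∩ Ham^ω_U(𝕋²)` as a subset of `Ham^ω_U(𝕋²)`. -/
def NDInHamU (n : ℕ) (U : Set ComplexTorus) : Set (HamU U) :=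
  {F | ∃ f ∈ NDSet n, Extends (F : C(U, ComplexTorus)) f}

end

/-! A Hamiltonian map has derivatives of determinant one, so `D(f^k)` at a periodic point is
hyperbolic or elliptic exactly when its trace is not `±2`. Openness is then a compactness argument.
The pair `(f^k(x), D(f^k)_x)` depends continuously on `(F, x)`, because locally uniform convergence
of holomorphic maps carries over to their derivatives (`continuous_jacEntry`). Degeneracy is a
closed condition, and the projection along the compact torus is closed.

Density is parametric transversality, with Hausdorff dimension in the role of Sard's theorem.
Compose `F` with finitely many shears generated by plane waves, with parameters `ε ∈ ℝ^m`; the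
shears extend to all of `ℂ²/ℤ²`, so the domain `U` is kept. Induct on the period: once smaller
periods are non-degenerate (together with their iterates up to period `n`), a degenerate point of
period `d + 1` has minimal period `d + 1`. Its orbit points are then distinct, and some
trigonometric polynomial is flat at all of them except the return point (`exists_trigSpace_flat`).
To first order such a kick gives the return point any displacement and multiplies the derivative
there by any infinitesimal shear. The two equations of periodicity and one equation `l M = l M₀`
expressing degeneracy are therefore independent in the `m + 2` unknowns `(ε, p)`. Their solutions
have dimension at most `m - 1`, as has the projection to `ε`, so the good parameters are dense
(`exists_forall_torusJacIter_notMem`).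

Degeneracy reduces to one equation because the traces of degenerate unimodular matrices form a
finite set: near `M₀` the trace must equal `tr M₀`. The trace is stationary under shears only at `M₀
= ±1`, so a preliminary perturbation removes these two values (`dense_nonDegUpTo`). -/

noncomputable section

/-! ### Area preservation of Hamiltonian flows -/

/-- The area of the parallelogram spanned by two vectors of the plane. -/
def planeArea (a b : ℝ × ℝ) : ℝ := a.1 * b.2 - a.2 * b.1

theorem planeArea_abs_le (a b : ℝ × ℝ) : |planeArea a b| ≤ 2 * ‖a‖ * ‖b‖ := by
  have h1 : |a.1| ≤ ‖a‖ := norm_fst_le a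
  have h2 : |a.2| ≤ ‖a‖ := norm_snd_le a
  have h3 : |b.1| ≤ ‖b‖ := norm_fst_le b
  have h4 : |b.2| ≤ ‖b‖ := norm_snd_le b
  calc |planeArea a b| ≤ |a.1 * b.2| + |a.2 * b.1| := abs_sub _ _
    _ = |a.1| * |b.2| + |a.2| * |b.1| := by rw [abs_mul, abs_mul]
    _ ≤ ‖a‖ * ‖b‖ + ‖a‖ * ‖b‖ := by gcongr
    _ = _ := by ring

/-- Lipschitz maps of the plane which distort the area of small parallelograms by a third order
term only. -/
def IsAreaLift (L : ℝ × ℝ → ℝ × ℝ) : Prop :=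
  (∃ C, 0 ≤ C ∧ ∀ p q, ‖L q - L p‖ ≤ C * ‖q - p‖) ∧
    ∃ K, 0 ≤ K ∧ ∀ p q r ρ, ‖q - p‖ ≤ ρ → ‖r - p‖ ≤ ρ →
      |planeArea (L q - L p) (L r - L p) - planeArea (q - p) (r - p)| ≤ K * ρ ^ 3

theorem IsAreaLift.continuous {L : ℝ × ℝ → ℝ × ℝ} (h : IsAreaLift L) : Continuous L := by
  obtain ⟨⟨C, hC, h⟩, -⟩ := h
  exact (LipschitzWith.of_dist_le_mul (K := ⟨C, hC⟩) fun p q => by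
    rw [dist_eq_norm, dist_eq_norm]; exact h q p).continuous

/-- A Lipschitz map rescales `ρ` by a constant, so cubic errors stay cubic. Area preservation in
this finite-difference form passes to compositions without differentiating any flow in its initial
condition. -/
theorem IsAreaLift.comp {L M : ℝ × ℝ → ℝ × ℝ} (hL : IsAreaLift L) (hM : IsAreaLift M) :
    IsAreaLift (L ∘ M) := by
  obtain ⟨⟨C, hC, h⟩, K, hK, hA⟩ := hL
  obtain ⟨⟨C', hC', h'⟩, K', hK', hA'⟩ := hM
  refine ⟨⟨C * C', by positivity, fun p q => ?_⟩, K * C' ^ 3 + K', by positivity,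
    fun p q r ρ hq hr => ?_⟩
  · calc ‖L (M q) - L (M p)‖ ≤ C * ‖M q - M p‖ := h _ _
      _ ≤ C * (C' * ‖q - p‖) := by gcongr; exact h' _ _
      _ = _ := by ring
  · have h1 := hA (M p) (M q) (M r) (C' * ρ) ((h' _ _).trans (by gcongr))
      ((h' _ _).trans (by gcongr))
    have h2 := hA' p q r ρ hq hr
    calc _ ≤ |planeArea (L (M q) - L (M p)) (L (M r) - L (M p)) -
              planeArea (M q - M p) (M r - M p)| +
            |planeArea (M q - M p) (M r - M p) - planeArea (q - p) (r - p)| :=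
          abs_sub_le _ _ _
      _ ≤ K * (C' * ρ) ^ 3 + K' * ρ ^ 3 := add_le_add h1 h2
      _ = _ := by ring

/-- The derivative of an area lift has determinant one. -/
theorem IsAreaLift.planeArea_map {L : ℝ × ℝ → ℝ × ℝ} (h : IsAreaLift L) {p : ℝ × ℝ}
    {A : ℝ × ℝ →L[ℝ] ℝ × ℝ} (hA : HasFDerivAt L A p) (a b : ℝ × ℝ) :
    planeArea (A a) (A b) = planeArea a b := by
  obtain ⟨-, K, hK, hA'⟩ := h
  have key : ∀ v : ℝ × ℝ, Tendsto (fun s : ℝ => s⁻¹ • (L (p + s • v) - L p)) (𝓝[≠] 0)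
      (𝓝 (A v)) := by
    intro v
    have h1 : HasDerivAt (fun s : ℝ => L (p + s • v)) (A v) 0 := by
      have h2 : HasDerivAt (fun s : ℝ => p + s • v) v 0 := by
        simpa using ((hasDerivAt_id (0 : ℝ)).smul_const v).const_add p
      have h3 : HasFDerivAt L A (p + (0 : ℝ) • v) := by simpa using hA
      exact h3.comp_hasDerivAt 0 h2
    have := h1.tendsto_slope_zero
    simpa using this
  have hcont : Continuous fun z : (ℝ × ℝ) × (ℝ × ℝ) => planeArea z.1 z.2 := by
    unfold planeArea; fun_prop
  have h1 := (hcont.tendsto (A a, A b)).comp ((key a).prodMk_nhds (key b))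
  -- At scale `s` areas are quadratic and the error is cubic, so division by `s ^ 2` leaves
  -- `O(|s|)`.
  have h2 : Tendsto (fun s : ℝ => planeArea (s⁻¹ • (L (p + s • a) - L p))
      (s⁻¹ • (L (p + s • b) - L p))) (𝓝[≠] 0) (𝓝 (planeArea a b)) := by
    rw [tendsto_iff_dist_tendsto_zero]
    have h3 : Tendsto (fun s : ℝ => K * (‖a‖ + ‖b‖) ^ 3 * |s|) (𝓝[≠] 0) (𝓝 0) := by
      have : Continuous fun s : ℝ => K * (‖a‖ + ‖b‖) ^ 3 * |s| := by fun_prop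
      simpa using (this.tendsto 0).mono_left nhdsWithin_le_nhds
    refine squeeze_zero' (Eventually.of_forall fun _ => dist_nonneg) ?_ h3
    filter_upwards [self_mem_nhdsWithin] with s hs
    have hs : s ≠ 0 := hs
    have h4 := hA' p (p + s • a) (p + s • b) (|s| * (‖a‖ + ‖b‖))
      (by rw [add_sub_cancel_left, norm_smul, Real.norm_eq_abs]; gcongr; simp)
      (by rw [add_sub_cancel_left, norm_smul, Real.norm_eq_abs]; gcongr; simp)
    rw [add_sub_cancel_left, add_sub_cancel_left] at h4
    have e1 : planeArea (s⁻¹ • (L (p + s • a) - L p)) (s⁻¹ • (L (p + s • b) - L p)) -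
        planeArea a b = (s⁻¹) ^ 2 * (planeArea (L (p + s • a) - L p) (L (p + s • b) - L p) -
          planeArea (s • a) (s • b)) := by
      simp only [planeArea, Prod.smul_fst, Prod.smul_snd, smul_eq_mul]
      field_simp
    rw [Real.dist_eq, e1, abs_mul, abs_pow, abs_inv]
    have hs' : 0 < |s| := abs_pos.mpr hs
    calc _ ≤ |s|⁻¹ ^ 2 * (K * (|s| * (‖a‖ + ‖b‖)) ^ 3) := by gcongr
      _ = _ := by field_simp
  exact tendsto_nhds_unique h1 h2

/-- A continuous function which is `ℤ²`-periodic in space is bounded for times in `[0, 1]`. -/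
theorem exists_norm_le_of_periodic {Y : Type*} [NormedAddCommGroup Y] {G : ℝ × (ℝ × ℝ) → Y}
    (hG : Continuous G)
    (hper : ∀ (m k : ℤ) (q : ℝ × (ℝ × ℝ)), G (q + ((0 : ℝ), ((m : ℝ), (k : ℝ)))) = G q) :
    ∃ K, 0 ≤ K ∧ ∀ q : ℝ × (ℝ × ℝ), q.1 ∈ Icc (0 : ℝ) 1 → ‖G q‖ ≤ K := by
  obtain ⟨K, hK⟩ := (isCompact_Icc.prod (isCompact_Icc.prod isCompact_Icc) :
    IsCompact (Icc (0 : ℝ) 1 ×ˢ (Icc (0 : ℝ) 1 ×ˢ Icc (0 : ℝ) 1))).exists_bound_of_continuousOn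
      hG.continuousOn
  refine ⟨max K 0, le_max_right _ _, fun q hq => ?_⟩
  rw [← hper (-⌊q.2.1⌋) (-⌊q.2.2⌋) q]
  refine (hK _ ⟨by simpa using hq, ?_, ?_⟩).trans (le_max_left _ _)
  · constructor
    · simpa using Int.floor_le q.2.1
    · simpa [add_comm] using (Int.lt_floor_add_one q.2.1).le
  · constructor
    · simpa using Int.floor_le q.2.2
    · simpa [add_comm] using (Int.lt_floor_add_one q.2.2).le

theorem realProj_add_int (p : ℝ × ℝ) (m k : ℤ) :
    realProj (p + ((m : ℝ), (k : ℝ))) = realProj p := by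
  have h : ∀ m : ℤ, ((m : ℝ) : AddCircle (1 : ℝ)) = 0 := fun m => by
    rw [AddCircle.coe_eq_zero_iff]; exact ⟨m, by simp⟩
  simp only [realProj, Prod.fst_add, Prod.snd_add, AddCircle.coe_add, h, add_zero]

/-- The flow of a vector field which is tame in the space variables and divergence free consists of
area lifts. -/
theorem isAreaLift_flow {X : ℝ × (ℝ × ℝ) → ℝ × ℝ} (hX : ContDiff ℝ 2 X)
    (hper : ∀ (m k : ℤ) (q : ℝ × (ℝ × ℝ)), X (q + ((0 : ℝ), ((m : ℝ), (k : ℝ)))) = X q)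
    (hdiv : ∀ q, (fderiv ℝ X q (0, (1, 0))).1 + (fderiv ℝ X q (0, (0, 1))).2 = 0)
    {φ : ℝ → ℝ × ℝ → ℝ × ℝ} (h0 : ∀ p, φ 0 p = p)
    (hφ : ∀ p t, HasDerivAt (fun s => φ s p) (X (t, φ t p)) t) : IsAreaLift (φ 1) := by
  have hd1 : Differentiable ℝ X := hX.differentiable (by norm_num)
  have hX' : ContDiff ℝ 1 (fderiv ℝ X) := hX.fderiv_right (by norm_num)
  have hd2 : Differentiable ℝ (fderiv ℝ X) := hX'.differentiable (by norm_num)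
  have hper1 : ∀ (m k : ℤ) (q : ℝ × (ℝ × ℝ)),
      fderiv ℝ X (q + ((0 : ℝ), ((m : ℝ), (k : ℝ)))) = fderiv ℝ X q := by
    intro m k q
    rw [← fderiv_comp_add_right]
    congr 1; ext1 x; exact hper m k x
  have hper2 : ∀ (m k : ℤ) (q : ℝ × (ℝ × ℝ)),
      fderiv ℝ (fderiv ℝ X) (q + ((0 : ℝ), ((m : ℝ), (k : ℝ)))) = fderiv ℝ (fderiv ℝ X) q := by
    intro m k q
    rw [← fderiv_comp_add_right]
    congr 1; ext1 x; exact hper1 m k x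
  obtain ⟨K₁, hK₁, hb1⟩ := exists_norm_le_of_periodic hX'.continuous hper1
  obtain ⟨K₂, hK₂, hb2⟩ := exists_norm_le_of_periodic (hX'.continuous_fderiv (by norm_num)) hper2
  have hconv : Convex ℝ (Icc (0 : ℝ) 1 ×ˢ (univ : Set (ℝ × ℝ))) :=
    (convex_Icc 0 1).prod convex_univ
  have hlip : ∀ t ∈ Icc (0 : ℝ) 1, ∀ p q, ‖X (t, q) - X (t, p)‖ ≤ K₁ * ‖q - p‖ := by
    intro t ht p q
    have := hconv.norm_image_sub_le_of_norm_fderiv_le (f := X) (C := K₁) (𝕜 := ℝ)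
      (fun x _ => hd1 x) (fun x hx => hb1 x hx.1) (x := (t, p)) (y := (t, q)) ⟨ht, trivial⟩
      ⟨ht, trivial⟩
    simpa [Prod.norm_def] using this
  have htaylor : ∀ t ∈ Icc (0 : ℝ) 1, ∀ p q,
      ‖X (t, q) - X (t, p) - fderiv ℝ X (t, p) (0, q - p)‖ ≤ K₂ * ‖q - p‖ ^ 2 := by
    intro t ht p q
    -- Mean value inequality for `X` minus its linearisation at `(t, p)`: on this segment the
    -- derivative of the difference is at most `K₂ * ‖q - p‖`.
    have hc : Convex ℝ ({t} ×ˢ segment ℝ p q) := (convex_singleton t).prod (convex_segment p q)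
    have := hc.norm_image_sub_le_of_norm_hasFDerivWithin_le (𝕜 := ℝ)
      (f := fun x => X x - fderiv ℝ X (t, p) x)
      (f' := fun x => fderiv ℝ X x - fderiv ℝ X (t, p)) (C := K₂ * ‖q - p‖)
      (fun x _ => ((hd1 x).hasFDerivAt.sub
        (fderiv ℝ X (t, p)).hasFDerivAt).hasFDerivWithinAt)
      (fun x hx => by
        have := hconv.norm_image_sub_le_of_norm_fderiv_le (f := fderiv ℝ X) (C := K₂) (𝕜 := ℝ)
          (fun x _ => hd2 x) (fun x hx => hb2 x hx.1) (x := (t, p)) (y := x)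
          ⟨ht, trivial⟩ ⟨by rw [show x.1 = t from hx.1]; exact ht, trivial⟩
        refine this.trans ?_
        gcongr
        have h1 : x - (t, p) = (0, x.2 - p) := by
          ext1 <;> simp [show x.1 = t from hx.1]
        rw [h1, Prod.norm_def]
        simpa using norm_sub_le_of_mem_segment hx.2)
      (x := (t, p)) (y := (t, q)) ⟨rfl, left_mem_segment _ _ _⟩ ⟨rfl, right_mem_segment _ _ _⟩
    have e : fderiv ℝ X (t, p) (0, q - p) = fderiv ℝ X (t, p) (t, q) - fderiv ℝ X (t, p) (t, p) := by
      rw [← map_sub]; congr 1; ext1 <;> simp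
    rw [e]
    have e2 : ‖((t, q) : ℝ × (ℝ × ℝ)) - (t, p)‖ = ‖q - p‖ := by simp [Prod.norm_def]
    rw [e2] at this
    calc _ = ‖X (t, q) - fderiv ℝ X (t, p) (t, q) - (X (t, p) - fderiv ℝ X (t, p) (t, p))‖ := by
          congr 1; abel
      _ ≤ _ := this
      _ = _ := by ring
  set C := Real.exp K₁ with hC
  have hgron : ∀ t ∈ Icc (0 : ℝ) 1, ∀ p q, ‖φ t q - φ t p‖ ≤ C * ‖q - p‖ := by
    intro t ht p q
    have := dist_le_of_trajectories_ODE_of_mem (v := fun t p => X (t, p)) (K := ⟨K₁, hK₁⟩)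
      (s := fun _ => univ) (f := fun t => φ t q) (g := fun t => φ t p) (a := 0) (b := 1)
      (δ := ‖q - p‖)
      (fun t ht => (LipschitzWith.of_dist_le_mul fun a b => by
        rw [dist_eq_norm, dist_eq_norm]
        exact hlip t ⟨ht.1, ht.2.le⟩ b a).lipschitzOnWith)
      (fun t _ => (hφ q t).continuousAt.continuousWithinAt)
      (fun t _ => (hφ q t).hasDerivWithinAt) (fun _ _ => trivial)
      (fun t _ => (hφ p t).continuousAt.continuousWithinAt)
      (fun t _ => (hφ p t).hasDerivWithinAt) (fun _ _ => trivial)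
      (by rw [h0, h0, dist_eq_norm]) t ht
    rw [dist_eq_norm] at this
    refine this.trans ?_
    rw [mul_comm]
    refine mul_le_mul_of_nonneg_right (Real.exp_le_exp.mpr ?_) (norm_nonneg _)
    change K₁ * (t - 0) ≤ K₁
    nlinarith [ht.1, ht.2]
  -- The Lipschitz constant is Grönwall's. In the cubic constant, one factor `2` comes from
  -- `planeArea_abs_le`, another from the two edges of the parallelogram. `K₂ * (C * ρ) ^ 2` bounds
  -- a Taylor remainder and `C * ρ` the other edge.
  refine ⟨⟨C, by positivity, hgron 1 (by simp)⟩, 4 * K₂ * C ^ 3, by positivity,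
    fun p q r ρ hq hr => ?_⟩
  have hC0 : 0 ≤ C := (Real.exp_pos _).le
  have hρ : 0 ≤ ρ := (norm_nonneg _).trans hq
  have hder : ∀ t ∈ Icc (0 : ℝ) 1, HasDerivWithinAt
      (fun t => planeArea (φ t q - φ t p) (φ t r - φ t p))
      (planeArea (X (t, φ t q) - X (t, φ t p)) (φ t r - φ t p) +
        planeArea (φ t q - φ t p) (X (t, φ t r) - X (t, φ t p))) (Icc 0 1) t := by
    intro t _
    have ha := (hφ q t).fun_sub (hφ p t)
    have hb := (hφ r t).fun_sub (hφ p t)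
    have ha1 := hasFDerivAt_fst.comp_hasDerivAt t ha
    have ha2 := hasFDerivAt_snd.comp_hasDerivAt t ha
    have hb1 := hasFDerivAt_fst.comp_hasDerivAt t hb
    have hb2 := hasFDerivAt_snd.comp_hasDerivAt t hb
    have := ((ha1.mul hb2).sub (ha2.mul hb1)).hasDerivWithinAt (s := Icc 0 1)
    refine (this.congr_deriv ?_)
    simp [planeArea]
    ring
  have hbound : ∀ t ∈ Ico (0 : ℝ) 1,
      ‖planeArea (X (t, φ t q) - X (t, φ t p)) (φ t r - φ t p) +
        planeArea (φ t q - φ t p) (X (t, φ t r) - X (t, φ t p))‖ ≤ 4 * K₂ * C ^ 3 * ρ ^ 3 := by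
    intro t ht
    have ht : t ∈ Icc (0 : ℝ) 1 := ⟨ht.1, ht.2.le⟩
    have hq' : ‖φ t q - φ t p‖ ≤ C * ρ := (hgron t ht p q).trans (by gcongr)
    have hr' : ‖φ t r - φ t p‖ ≤ C * ρ := (hgron t ht p r).trans (by gcongr)
    have tq := htaylor t ht (φ t p) (φ t q)
    have tr := htaylor t ht (φ t p) (φ t r)
    set a := φ t q - φ t p
    set b := φ t r - φ t p
    set A := fderiv ℝ X (t, φ t p) with hAdef
    set Ra := X (t, φ t q) - X (t, φ t p) - A (0, a)
    set Rb := X (t, φ t r) - X (t, φ t p) - A (0, b)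
    have hA : ∀ v : ℝ × ℝ, A (0, v) = v.1 • A (0, (1, 0)) + v.2 • A (0, (0, 1)) := by
      intro v
      rw [← map_smul, ← map_smul, ← map_add]
      congr 1
      ext <;> simp
    have e1 : X (t, φ t q) - X (t, φ t p) = Ra + A (0, a) := by simp [Ra]
    have e2 : X (t, φ t r) - X (t, φ t p) = Rb + A (0, b) := by simp [Rb]
    have hd := hdiv (t, φ t p)
    rw [← hAdef] at hd
    -- `A (0, ·)` has trace zero, so its infinitesimal action on areas vanishes; only the Taylor
    -- remainders survive.
    have e3 : planeArea (Ra + A (0, a)) b + planeArea a (Rb + A (0, b)) =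
        planeArea Ra b + planeArea a Rb := by
      rw [hA a, hA b]
      simp only [planeArea, Prod.fst_add, Prod.snd_add, Prod.smul_fst, Prod.smul_snd, smul_eq_mul]
      linear_combination (a.1 * b.2 - a.2 * b.1) * hd
    rw [e1, e2, e3, Real.norm_eq_abs]
    calc _ ≤ |planeArea Ra b| + |planeArea a Rb| := abs_add_le _ _
      _ ≤ 2 * ‖Ra‖ * ‖b‖ + 2 * ‖a‖ * ‖Rb‖ := add_le_add (planeArea_abs_le _ _)
          (planeArea_abs_le _ _)
      _ ≤ 2 * (K₂ * (C * ρ) ^ 2) * (C * ρ) + 2 * (C * ρ) * (K₂ * (C * ρ) ^ 2) := by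
          gcongr
          · exact tq.trans (by gcongr)
          · exact tr.trans (by gcongr)
      _ = _ := by ring
  have := norm_image_sub_le_of_norm_deriv_le_segment' hder hbound 1 (by simp)
  simpa [h0] using this

/-- The time-one map of the lift of an analytic Hamiltonian flow is an area lift. -/
theorem isAreaLift_hamFlow {H : ℝ → RealTorus → ℝ} {φ : ℝ → ℝ × ℝ → ℝ × ℝ}
    (hH : AnalyticOnNhd ℝ (fun q : ℝ × (ℝ × ℝ) => H q.1 (realProj q.2)) univ)
    (h0 : ∀ p, φ 0 p = p)
    (hφ : ∀ p t, HasDerivAt (fun s => φ s p) (hamVectorField H t (φ t p)) t) :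
    IsAreaLift (φ 1) := by
  set G : ℝ × (ℝ × ℝ) → ℝ := fun q => H q.1 (realProj q.2) with hG
  have hG3 : ContDiff ℝ 3 G := hH.contDiff
  have hGd : Differentiable ℝ G := hG3.differentiable (by norm_num)
  have hG2 : ContDiff ℝ 2 (fderiv ℝ G) := hG3.fderiv_right (by norm_num)
  have hperG : ∀ (m k : ℤ) (q : ℝ × (ℝ × ℝ)),
      fderiv ℝ G (q + ((0 : ℝ), ((m : ℝ), (k : ℝ)))) = fderiv ℝ G q := by
    intro m k q
    rw [← fderiv_comp_add_right]
    congr 1; ext1 x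
    simp [hG, realProj_add_int]
  have hX : ContDiff ℝ 2 fun q => ((fderiv ℝ G q (0, (0, 1)), -fderiv ℝ G q (0, (1, 0))) : ℝ × ℝ) :=
    (hG2.clm_apply contDiff_const).prodMk (hG2.clm_apply contDiff_const).neg
  refine isAreaLift_flow hX (fun m k q => by simp only [hperG]) (fun q => ?_) h0 (fun p t => ?_)
  · have hd : ∀ v, HasFDerivAt (fun q => fderiv ℝ G q v)
        ((fderiv ℝ (fderiv ℝ G) q).flip v) q := fun v => by
      have := (((hG2.differentiable (by norm_num)) q).hasFDerivAt).clm_apply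
        (hasFDerivAt_const v q)
      simpa using this
    have h2 := (hd (0, (0, 1))).prodMk (hd (0, (1, 0))).fun_neg
    rw [h2.fderiv]
    -- The divergence vanishes by symmetry of the second derivative.
    have hs := (hG3.contDiffAt (x := q)).isSymmSndFDerivAt (by simp; norm_num) (0, (1, 0)) (0, (0, 1))
    simp [hs]
  · have := hφ p t
    refine this.congr_deriv ?_
    unfold hamVectorField
    have h1 : HasDerivAt (fun y : ℝ => H t (realProj ((φ t p).1, y)))
        (fderiv ℝ G (t, φ t p) (0, (0, 1))) (φ t p).2 := by
      have hc : HasDerivAt (fun y : ℝ => ((t, ((φ t p).1, y)) : ℝ × (ℝ × ℝ))) (0, (0, 1))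
          (φ t p).2 :=
        (hasDerivAt_const _ _).prodMk ((hasDerivAt_const _ _).prodMk (hasDerivAt_id _))
      exact HasFDerivAt.comp_hasDerivAt (f := fun y : ℝ => ((t, ((φ t p).1, y)) : ℝ × (ℝ × ℝ)))
        _ (hGd (t, φ t p)).hasFDerivAt hc
    have h2 : HasDerivAt (fun x : ℝ => H t (realProj (x, (φ t p).2)))
        (fderiv ℝ G (t, φ t p) (0, (1, 0))) (φ t p).1 := by
      have hc : HasDerivAt (fun x : ℝ => ((t, (x, (φ t p).2)) : ℝ × (ℝ × ℝ))) (0, (1, 0))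
          (φ t p).1 :=
        (hasDerivAt_const _ _).prodMk ((hasDerivAt_id _).prodMk (hasDerivAt_const _ _))
      exact HasFDerivAt.comp_hasDerivAt (f := fun x : ℝ => ((t, (x, (φ t p).2)) : ℝ × (ℝ × ℝ)))
        _ (hGd (t, φ t p)).hasFDerivAt hc
    rw [h1.deriv, h2.deriv]

theorem IsHamTimeOneMap.exists_isAreaLift {f : RealTorus → RealTorus} (hf : IsHamTimeOneMap f) :
    ∃ L, IsAreaLift L ∧ ∀ p, f (realProj p) = realProj (L p) := by
  obtain ⟨H, φ, hH, h0, hφ, hfφ⟩ := hf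
  exact ⟨φ 1, isAreaLift_hamFlow hH h0 hφ, hfφ⟩

theorem IsHamDiffeo.exists_isAreaLift {f : RealTorus → RealTorus} (hf : IsHamDiffeo f) :
    ∃ L, IsAreaLift L ∧ ∀ p, f (realProj p) = realProj (L p) := by
  induction hf with
  | timeOne hf => exact hf.exists_isAreaLift
  | comp _ _ ihf ihg =>
    obtain ⟨L, hL, hL'⟩ := ihf
    obtain ⟨M, hM, hM'⟩ := ihg
    exact ⟨L ∘ M, hL.comp hM, fun p => by simp [hM', hL']⟩

end

noncomputable section

/-! ### The two tori -/

theorem isOpenQuotientMap_realProj : IsOpenQuotientMap realProj :=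
  (QuotientAddGroup.isOpenQuotientMap_mk (N := AddSubgroup.zmultiples (1 : ℝ))).prodMap
    (QuotientAddGroup.isOpenQuotientMap_mk (N := AddSubgroup.zmultiples (1 : ℝ)))

theorem isOpenQuotientMap_complexProj : IsOpenQuotientMap complexProj :=
  (QuotientAddGroup.isOpenQuotientMap_mk (N := AddSubgroup.zmultiples (1 : ℂ))).prodMap
    (QuotientAddGroup.isOpenQuotientMap_mk (N := AddSubgroup.zmultiples (1 : ℂ)))

theorem continuous_realProj : Continuous realProj := isOpenQuotientMap_realProj.continuous

theorem continuous_complexProj : Continuous complexProj := isOpenQuotientMap_complexProj.continuous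

theorem realProj_surjective : Function.Surjective realProj := isOpenQuotientMap_realProj.surjective

theorem complexProj_surjective : Function.Surjective complexProj :=
  isOpenQuotientMap_complexProj.surjective

theorem complexProj_add (z w : ℂ × ℂ) : complexProj (z + w) = complexProj z + complexProj w := rfl

theorem realProj_eq_iff {p q : ℝ × ℝ} :
    realProj p = realProj q ↔ ∃ m k : ℤ, p = q + ((m : ℝ), (k : ℝ)) := by
  constructor
  · intro h
    have h1 : ((p.1 : ℝ) : AddCircle (1 : ℝ)) = q.1 := congrArg Prod.fst h
    have h2 : ((p.2 : ℝ) : AddCircle (1 : ℝ)) = q.2 := congrArg Prod.snd h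
    obtain ⟨m, hm⟩ := QuotientAddGroup.eq_iff_sub_mem.mp h1
    obtain ⟨k, hk⟩ := QuotientAddGroup.eq_iff_sub_mem.mp h2
    refine ⟨m, k, ?_⟩
    simp only [zsmul_eq_mul, mul_one] at hm hk
    ext <;> simp [hm, hk]
  · rintro ⟨m, k, rfl⟩
    exact realProj_add_int q m k

/-- Every point of the torus has a representative in the unit square. -/
theorem exists_realProj_eq (x : RealTorus) :
    ∃ p ∈ Icc (0 : ℝ) 1 ×ˢ Icc (0 : ℝ) 1, realProj p = x := by
  obtain ⟨p, rfl⟩ := realProj_surjective x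
  refine ⟨(Int.fract p.1, Int.fract p.2), ⟨⟨Int.fract_nonneg _, (Int.fract_lt_one _).le⟩,
    ⟨Int.fract_nonneg _, (Int.fract_lt_one _).le⟩⟩, ?_⟩
  rw [realProj_eq_iff]
  refine ⟨-⌊p.1⌋, -⌊p.2⌋, ?_⟩
  ext <;> simp [Int.fract, sub_eq_add_neg]

/-- The difference of two continuous functions is locally constant where it is integral. -/
theorem eventually_sub_eq_of_realProj_eq {X : Type*} [TopologicalSpace X] {u v : X → ℝ × ℝ} {p : X}
    (hu : ContinuousAt u p) (hv : ContinuousAt v p) (h : realProj (u p) = realProj (v p)) :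
    ∀ᶠ q in 𝓝 p, realProj (u q) = realProj (v q) → u q - v q = u p - v p := by
  have hc : ContinuousAt (fun q => u q - v q) p := hu.sub hv
  have h1 : ∀ᶠ q in 𝓝 p, ‖(u q - v q) - (u p - v p)‖ < 1 := by
    have := Metric.tendsto_nhds.mp hc 1 one_pos
    simpa [dist_eq_norm] using this
  obtain ⟨m₀, k₀, h0⟩ := realProj_eq_iff.mp h
  filter_upwards [h1] with q hq1 hq2
  obtain ⟨m, k, hmk⟩ := realProj_eq_iff.mp hq2
  rw [h0, hmk, add_sub_cancel_left, add_sub_cancel_left] at hq1 ⊢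
  have h2 : |((m - m₀ : ℤ) : ℝ)| < 1 := by
    have := (norm_fst_le _).trans_lt hq1
    simpa using this
  have h3 : |((k - k₀ : ℤ) : ℝ)| < 1 := by
    have := (norm_snd_le _).trans_lt hq1
    simpa using this
  have h2' : m - m₀ = 0 := Int.abs_lt_one_iff.mp (by exact_mod_cast h2)
  have h3' : k - k₀ = 0 := Int.abs_lt_one_iff.mp (by exact_mod_cast h3)
  rw [sub_eq_zero.mp h2', sub_eq_zero.mp h3']

/-- The inclusion `ℝ² ⊆ ℂ²`. -/
def planeIncl : ℝ × ℝ →L[ℝ] ℂ × ℂ := Complex.ofRealCLM.prodMap Complex.ofRealCLM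

@[simp] theorem planeIncl_apply (p : ℝ × ℝ) : planeIncl p = ((p.1 : ℂ), (p.2 : ℂ)) := rfl

theorem torusIncl_realProj (p : ℝ × ℝ) : torusIncl (realProj p) = complexProj (planeIncl p) := rfl

/-- The projection `ℂ/ℤ → ℝ/ℤ` to the real part. -/
def circleRe : AddCircle (1 : ℂ) →+ AddCircle (1 : ℝ) :=
  QuotientAddGroup.map _ _ Complex.reAddGroupHom (by
    rw [AddSubgroup.zmultiples_le]
    exact ⟨1, by simp⟩)

theorem continuous_circleRe : Continuous circleRe := by
  refine (QuotientAddGroup.isQuotientMap_mk (AddSubgroup.zmultiples (1 : ℂ))).continuous_iff.mpr ?_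
  exact (AddCircle.continuous_mk' 1).comp Complex.continuous_re

theorem continuous_circleIncl : Continuous circleIncl := by
  refine (QuotientAddGroup.isQuotientMap_mk (AddSubgroup.zmultiples (1 : ℝ))).continuous_iff.mpr ?_
  exact (AddCircle.continuous_mk' 1).comp Complex.continuous_ofReal

/-- The projection `ℂ²/ℤ² → ℝ²/ℤ²` to the real part. -/
def torusRe (z : ComplexTorus) : RealTorus := (circleRe z.1, circleRe z.2)

theorem continuous_torusRe : Continuous torusRe :=
  (continuous_circleRe.comp continuous_fst).prodMk (continuous_circleRe.comp continuous_snd)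

theorem continuous_torusIncl : Continuous torusIncl :=
  (continuous_circleIncl.comp continuous_fst).prodMk (continuous_circleIncl.comp continuous_snd)

theorem torusRe_complexProj (z : ℂ × ℂ) : torusRe (complexProj z) = realProj (z.1.re, z.2.re) := rfl

theorem torusRe_torusIncl (x : RealTorus) : torusRe (torusIncl x) = x := by
  obtain ⟨p, rfl⟩ := realProj_surjective x
  simp [torusIncl_realProj, torusRe_complexProj]

/-- The function `z ↦ exp (2πiz)` on `ℂ/ℤ`. -/
def circleExp : AddCircle (1 : ℂ) → ℂ :=
  Function.Periodic.lift (f := fun z : ℂ => Complex.exp (2 * Real.pi * Complex.I * z)) (c := 1)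
    fun z => by
      beta_reduce
      rw [mul_add, mul_one, Complex.exp_add, Complex.exp_two_pi_mul_I, mul_one]

theorem circleExp_coe (z : ℂ) :
    circleExp (z : AddCircle (1 : ℂ)) = Complex.exp (2 * Real.pi * Complex.I * z) := rfl

theorem continuous_circleExp : Continuous circleExp := by
  refine (QuotientAddGroup.isQuotientMap_mk (AddSubgroup.zmultiples (1 : ℂ))).continuous_iff.mpr ?_
  change Continuous fun z : ℂ => Complex.exp (2 * Real.pi * Complex.I * z)
  fun_prop

/-! ### The real map underlying a holomorphic map -/

variable {U : Set ComplexTorus}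

/-- The self-map of `𝕋²` underlying a map `U → ℂ²/ℤ²`. -/
def realMap (hUT : ∀ x, torusIncl x ∈ U) (F : U → ComplexTorus) (x : RealTorus) : RealTorus :=
  torusRe (F ⟨torusIncl x, hUT x⟩)

theorem Extends.realMap_eq (hUT : ∀ x, torusIncl x ∈ U) {F : U → ComplexTorus}
    {f : RealTorus → RealTorus} (h : Extends F f) : realMap hUT F = f := by
  ext1 x
  rw [realMap, h x (hUT x), torusRe_torusIncl]

theorem isHamDiffeo_realMap (hUT : ∀ x, torusIncl x ∈ U) {F : C(U, ComplexTorus)}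
    (hF : F ∈ HamU U) : IsHamDiffeo (realMap hUT F) := by
  obtain ⟨-, f, hf, hFf⟩ := hF
  rwa [hFf.realMap_eq hUT]

theorem extends_realMap (hUT : ∀ x, torusIncl x ∈ U) {F : C(U, ComplexTorus)}
    (hF : F ∈ HamU U) : Extends F (realMap hUT F) := by
  obtain ⟨-, f, hf, hFf⟩ := hF
  rwa [hFf.realMap_eq hUT]

/-- `F` determines the real map it extends, so the existential in `NDInHamU` has only one candidate.
-/
theorem mem_NDInHamU_iff (hUT : ∀ x, torusIncl x ∈ U) {n : ℕ} {F : HamU U} :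
    F ∈ NDInHamU n U ↔ realMap hUT F.1 ∈ NDSet n := by
  constructor
  · rintro ⟨f, hf, hFf⟩
    rwa [hFf.realMap_eq hUT]
  · intro h
    exact ⟨_, h, extends_realMap hUT F.2⟩

/-- A smooth area lift of a self-map of the torus. -/
structure IsSmoothLift (f : RealTorus → RealTorus) (L : ℝ × ℝ → ℝ × ℝ) : Prop where
  isAreaLift : IsAreaLift L
  realProj_apply : ∀ p, realProj (L p) = f (realProj p)
  contDiff : ContDiff ℝ ⊤ L

/-- The lift built from flows is only known to be Lipschitz. Its regularity comes from the
holomorphic extension: near each point it differs by a constant integer vector from the real part of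
a holomorphic chart representative. -/
theorem exists_isSmoothLift (hUT : ∀ x, torusIncl x ∈ U) {F : C(U, ComplexTorus)}
    (hF : F ∈ HamU U) : ∃ L, IsSmoothLift (realMap hUT F) L := by
  obtain ⟨L, hL, hL'⟩ := (isHamDiffeo_realMap hUT hF).exists_isAreaLift
  refine ⟨L, hL, fun p => (hL' p).symm, contDiff_iff_contDiffAt.mpr fun p => ?_⟩
  obtain ⟨g, hg, hFg⟩ := hF.1 (planeIncl p) (hUT (realProj p))
  have hg1 : ContDiffAt ℝ ⊤ (fun q => g (planeIncl q)) p :=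
    ((hg.contDiffAt (n := ⊤)).restrict_scalars ℝ).comp p planeIncl.contDiff.contDiffAt
  set u : ℝ × ℝ → ℝ × ℝ := fun q => ((g (planeIncl q)).1.re, (g (planeIncl q)).2.re) with hu
  have hu1 : ContDiffAt ℝ ⊤ u p :=
    (Complex.reCLM.contDiff.contDiffAt.comp p hg1.fst).prodMk
      (Complex.reCLM.contDiff.contDiffAt.comp p hg1.snd)
  have hev : ∀ᶠ q in 𝓝 p, realProj (L q) = realProj (u q) := by
    filter_upwards [planeIncl.continuous.continuousAt.eventually hFg] with q hq
    obtain ⟨hw, hq⟩ := hq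
    rw [← hL']
    change torusRe (F _) = torusRe (complexProj (g (planeIncl q)))
    rw [← hq]
    rfl
  have := eventually_sub_eq_of_realProj_eq hL.continuous.continuousAt hu1.continuousAt hev.self_of_nhds
  have h2 : L =ᶠ[𝓝 p] fun q => u q + (L p - u p) := by
    filter_upwards [this, hev] with q hq hq'
    rw [← hq hq']; abel
  exact (hu1.add contDiffAt_const).congr_of_eventuallyEq h2

namespace IsSmoothLift

variable {f g : RealTorus → RealTorus} {L M : ℝ × ℝ → ℝ × ℝ}

theorem comp (hL : IsSmoothLift f L) (hM : IsSmoothLift g M) : IsSmoothLift (f ∘ g) (L ∘ M) where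
  isAreaLift := hL.isAreaLift.comp hM.isAreaLift
  realProj_apply p := by simp [hL.realProj_apply, hM.realProj_apply]
  contDiff := hL.contDiff.comp hM.contDiff

theorem id : IsSmoothLift _root_.id _root_.id where
  isAreaLift := ⟨⟨1, zero_le_one, by simp⟩, 0, le_rfl, by simp⟩
  realProj_apply p := rfl
  contDiff := contDiff_id

theorem iterate (hL : IsSmoothLift f L) (k : ℕ) : IsSmoothLift f^[k] L^[k] := by
  induction k with
  | zero => exact IsSmoothLift.id
  | succ k ih => rw [Function.iterate_succ, Function.iterate_succ]; exact ih.comp hL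

theorem differentiable (hL : IsSmoothLift f L) : Differentiable ℝ L :=
  hL.contDiff.differentiable (by simp)

/-- The representative `g` in `HasTorusDerivAt` is arbitrary, but near `p` it differs from `L` by a
constant, so the lift computes every derivative on the torus. -/
theorem exists_hasFDerivAt (hL : IsSmoothLift f L) {A : ℝ × ℝ →L[ℝ] ℝ × ℝ} {x : RealTorus}
    (h : HasTorusDerivAt f A x) : ∃ p, realProj p = x ∧ HasFDerivAt L A p := by
  obtain ⟨p, g, hp, hg, hA⟩ := h
  refine ⟨p, hp, ?_⟩
  have hev : ∀ᶠ q in 𝓝 p, realProj (L q) = realProj (g q) :=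
    hg.mono fun q hq => by rw [hL.realProj_apply, hq]
  have h1 := eventually_sub_eq_of_realProj_eq hL.isAreaLift.continuous.continuousAt
    hA.continuousAt hev.self_of_nhds
  have h2 : L =ᶠ[𝓝 p] fun q => g q + (L p - g p) := by
    filter_upwards [h1, hev] with q hq hq'
    rw [← hq hq']; abel
  exact (hA.add_const _).congr_of_eventuallyEq h2

theorem hasTorusDerivAt (hL : IsSmoothLift f L) {A : ℝ × ℝ →L[ℝ] ℝ × ℝ} {p : ℝ × ℝ}
    (h : HasFDerivAt L A p) : HasTorusDerivAt f A (realProj p) :=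
  ⟨p, L, rfl, Eventually.of_forall hL.realProj_apply, h⟩

end IsSmoothLift

/-! ### The Jacobian as a function on the torus -/

/-- The function `w ↦ exp (2πi F_j(x + we))` of a complex variable `w`, with `F_j` the component of
`F` selected by `c`. -/
def angularFun (F : U → ComplexTorus) (c : ComplexTorus → AddCircle (1 : ℂ)) (e : ℂ × ℂ)
    (x : RealTorus) (w : ℂ) : ℂ :=
  open Classical in
  if h : torusIncl x + complexProj (w • e) ∈ U then circleExp (c (F ⟨_, h⟩)) else 0

/-- The derivative of the component of `F` selected by `c` at `x` in the direction `e`. -/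
def jacEntry (F : U → ComplexTorus) (c : ComplexTorus → AddCircle (1 : ℂ)) (e : ℂ × ℂ)
    (x : RealTorus) : ℝ :=
  (deriv (angularFun F c e x) 0 / (2 * Real.pi * Complex.I * angularFun F c e x 0)).re

/-- The linear map of the plane with given columns. -/
def ofColumns (a b : ℝ × ℝ) : ℝ × ℝ →L[ℝ] ℝ × ℝ :=
  (ContinuousLinearMap.fst ℝ ℝ ℝ).smulRight a + (ContinuousLinearMap.snd ℝ ℝ ℝ).smulRight b

theorem ofColumns_apply (a b v : ℝ × ℝ) : ofColumns a b v = v.1 • a + v.2 • b := rfl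

theorem ofColumns_eq (A : ℝ × ℝ →L[ℝ] ℝ × ℝ) : ofColumns (A (1, 0)) (A (0, 1)) = A := by
  ext <;> simp [ofColumns_apply]

theorem continuous_ofColumns :
    Continuous fun z : (ℝ × ℝ) × (ℝ × ℝ) => ofColumns z.1 z.2 := by
  unfold ofColumns
  have h (l : ℝ × ℝ →L[ℝ] ℝ) : Continuous fun a : ℝ × ℝ => l.smulRight a :=
    (ContinuousLinearMap.smulRightL ℝ (ℝ × ℝ) (ℝ × ℝ) l).continuous
  exact ((h _).comp continuous_fst).add ((h _).comp continuous_snd)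

/-- The derivative of `F` along the real torus, in terms of the angular functions of `F`. -/
def torusJac (F : U → ComplexTorus) (x : RealTorus) : ℝ × ℝ →L[ℝ] ℝ × ℝ :=
  ofColumns (jacEntry F Prod.fst (1, 0) x, jacEntry F Prod.snd (1, 0) x)
    (jacEntry F Prod.fst (0, 1) x, jacEntry F Prod.snd (0, 1) x)

theorem differentiableAt_angularFun {F : U → ComplexTorus} (hF : IsHolomorphicOnTorus F)
    {c : ComplexTorus → AddCircle (1 : ℂ)} {l : ℂ × ℂ →L[ℂ] ℂ}
    (hcl : ∀ z, c (complexProj z) = (l z : AddCircle (1 : ℂ))) (e : ℂ × ℂ) (x : RealTorus) {w : ℂ}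
    (hw : torusIncl x + complexProj (w • e) ∈ U) :
    DifferentiableAt ℂ (angularFun F c e x) w := by
  obtain ⟨p, rfl⟩ := realProj_surjective x
  obtain ⟨g, hg, hFg⟩ := hF (planeIncl p + w • e) hw
  have hc : Differentiable ℂ fun w : ℂ => planeIncl p + w • e := by fun_prop
  have h1 : angularFun F c e (realProj p) =ᶠ[𝓝 w]
      fun w => Complex.exp (2 * Real.pi * Complex.I * l (g (planeIncl p + w • e))) := by
    filter_upwards [hc.continuous.continuousAt.eventually hFg] with v hv
    obtain ⟨hv, hv'⟩ := hv
    have hv2 : torusIncl (realProj p) + complexProj (v • e) ∈ U := hv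
    rw [angularFun, dif_pos hv2]
    have : F ⟨_, hv2⟩ = complexProj (g (planeIncl p + v • e)) := hv'
    rw [this, hcl, circleExp_coe]
  refine DifferentiableAt.congr_of_eventuallyEq ?_ h1
  have h2 : DifferentiableAt ℂ (fun w : ℂ => g (planeIncl p + w • e)) w :=
    DifferentiableAt.comp w hg.differentiableAt (hc w)
  have h3 : DifferentiableAt ℂ (fun w : ℂ => l (g (planeIncl p + w • e))) w :=
    DifferentiableAt.comp w l.differentiableAt h2
  exact (h3.const_mul _).cexp

/-- For real `w = t` the angular function is `exp (2πi l'(L(p + tv)))`, so its logarithmic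
derivative over `2πi` is the derivative of `l' ∘ L`. The detour through the exponential expresses
the Jacobian by `F` alone, as a quotient of complex-valued holomorphic data, which makes it visibly
continuous in `F`. -/
theorem jacEntry_eq (hUT : ∀ x, torusIncl x ∈ U) {F : C(U, ComplexTorus)} (hF : F ∈ HamU U)
    {L : ℝ × ℝ → ℝ × ℝ} (hL : IsSmoothLift (realMap hUT F) L)
    {c : ComplexTorus → AddCircle (1 : ℂ)} {l : ℂ × ℂ →L[ℂ] ℂ}
    (hcl : ∀ z, c (complexProj z) = (l z : AddCircle (1 : ℂ))) {l' : ℝ × ℝ →L[ℝ] ℝ}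
    (hll : ∀ q, l (planeIncl q) = l' q)
    (v p : ℝ × ℝ) : jacEntry F c (planeIncl v) (realProj p) = l' (fderiv ℝ L p v) := by
  have hU0 : torusIncl (realProj p) + complexProj ((0 : ℂ) • planeIncl v) ∈ U := by
    have : complexProj ((0 : ℂ) • planeIncl v) = 0 := by rw [zero_smul]; rfl
    rw [this, add_zero]; exact hUT _
  have h1 := (differentiableAt_angularFun hF.1 hcl (planeIncl v) (realProj p) hU0).hasDerivAt
  have hval : ∀ t : ℝ, angularFun F c (planeIncl v) (realProj p) t =
      Complex.exp (2 * Real.pi * Complex.I * (l' (L (p + t • v)) : ℝ)) := by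
    intro t
    have e : torusIncl (realProj p) + complexProj ((t : ℂ) • planeIncl v) =
        torusIncl (realProj (p + t • v)) := by
      rw [torusIncl_realProj, torusIncl_realProj, ← complexProj_add]
      congr 1
      ext <;> simp
    have e' : torusIncl (realProj p) + complexProj ((t : ℂ) • planeIncl v) ∈ U := by
      rw [e]; exact hUT _
    rw [angularFun, dif_pos e']
    have : (⟨_, e'⟩ : U) = ⟨torusIncl (realProj (p + t • v)), hUT _⟩ := Subtype.ext e
    rw [this, extends_realMap hUT hF _ _, ← hL.realProj_apply, torusIncl_realProj, hcl,
      circleExp_coe, hll]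
  have h2 : HasDerivAt (fun t : ℝ => angularFun F c (planeIncl v) (realProj p) t)
      (deriv (angularFun F c (planeIncl v) (realProj p)) 0) 0 := by
    have := h1
    rw [← Complex.ofReal_zero] at this
    simpa using this.comp_ofReal
  have h3 : HasDerivAt (fun t : ℝ => l' (L (p + t • v))) (l' (fderiv ℝ L p v)) 0 := by
    have h4 : HasDerivAt (fun s : ℝ => p + s • v) v 0 := by
      simpa using ((hasDerivAt_id (0 : ℝ)).smul_const v).const_add p
    have h5 : HasFDerivAt L (fderiv ℝ L p) (p + (0 : ℝ) • v) := by
      simpa using (hL.differentiable p).hasFDerivAt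
    exact (l'.hasFDerivAt.comp_hasDerivAt (0 : ℝ) (h5.comp_hasDerivAt 0 h4))
  have h6 := ((h3.ofReal_comp.const_mul (2 * Real.pi * Complex.I)).cexp)
  have h7 : HasDerivAt (fun t : ℝ => angularFun F c (planeIncl v) (realProj p) t) _ 0 :=
    h6.congr_of_eventuallyEq (Eventually.of_forall hval)
  have h8 := h2.unique h7
  have h9 := hval 0
  rw [Complex.ofReal_zero] at h9
  rw [jacEntry, h8, h9]
  have hexp := Complex.exp_ne_zero (2 * Real.pi * Complex.I * (l' (L (p + (0 : ℝ) • v)) : ℝ))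
  have hpi : (Real.pi : ℂ) ≠ 0 := by exact_mod_cast Real.pi_ne_zero
  have hI := Complex.I_ne_zero
  rw [← Complex.ofReal_re (l' (fderiv ℝ L p v))]
  congr 1
  rw [Complex.ofReal_re]
  field_simp

theorem torusJac_realProj (hUT : ∀ x, torusIncl x ∈ U) {F : C(U, ComplexTorus)} (hF : F ∈ HamU U)
    {L : ℝ × ℝ → ℝ × ℝ} (hL : IsSmoothLift (realMap hUT F) L) (p : ℝ × ℝ) :
    torusJac F (realProj p) = fderiv ℝ L p := by
  have h1 : ∀ v : ℝ × ℝ, jacEntry F Prod.fst (planeIncl v) (realProj p) = (fderiv ℝ L p v).1 :=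
    fun v => jacEntry_eq hUT hF hL (l := ContinuousLinearMap.fst ℂ ℂ ℂ)
      (l' := ContinuousLinearMap.fst ℝ ℝ ℝ) (fun _ => rfl) (fun _ => rfl) v p
  have h2 : ∀ v : ℝ × ℝ, jacEntry F Prod.snd (planeIncl v) (realProj p) = (fderiv ℝ L p v).2 :=
    fun v => jacEntry_eq hUT hF hL (l := ContinuousLinearMap.snd ℂ ℂ ℂ)
      (l' := ContinuousLinearMap.snd ℝ ℝ ℝ) (fun _ => rfl) (fun _ => rfl) v p
  rw [← ofColumns_eq (fderiv ℝ L p), torusJac]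
  have e1 : ((1 : ℂ), (0 : ℂ)) = planeIncl (1, 0) := by simp
  have e2 : ((0 : ℂ), (1 : ℂ)) = planeIncl (0, 1) := by simp
  rw [e1, e2, h1, h2, h1, h2]

end

noncomputable section

/-! ### Continuous dependence on the map -/

variable {U : Set ComplexTorus}

theorem continuous_realMap (hUo : IsOpen U) (hUT : ∀ x, torusIncl x ∈ U) :
    Continuous fun z : C(U, ComplexTorus) × RealTorus => realMap hUT z.1 z.2 := by
  have := hUo.locallyCompactSpace
  refine continuous_torusRe.comp ?_
  have h : Continuous fun z : C(U, ComplexTorus) × RealTorus =>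
      (⟨torusIncl z.2, hUT z.2⟩ : U) :=
    (continuous_torusIncl.comp continuous_snd).subtype_mk _
  exact continuous_fst.eval h

theorem continuousAt_angularFun (hUo : IsOpen U) {c : ComplexTorus → AddCircle (1 : ℂ)}
    (hc : Continuous c) (e : ℂ × ℂ) {z₀ : (C(U, ComplexTorus) × RealTorus) × ℂ}
    (hz₀ : torusIncl z₀.1.2 + complexProj (z₀.2 • e) ∈ U) :
    ContinuousAt (fun z : (C(U, ComplexTorus) × RealTorus) × ℂ =>
      angularFun z.1.1 c e z.1.2 z.2) z₀ := by
  have := hUo.locallyCompactSpace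
  have hpos : Continuous fun z : (C(U, ComplexTorus) × RealTorus) × ℂ =>
      torusIncl z.1.2 + complexProj (z.2 • e) :=
    (continuous_torusIncl.comp (by fun_prop)).add (continuous_complexProj.comp (by fun_prop))
  set Ω : Set ((C(U, ComplexTorus) × RealTorus) × ℂ) :=
    {z | torusIncl z.1.2 + complexProj (z.2 • e) ∈ U} with hΩ
  have hΩo : IsOpen Ω := hUo.preimage hpos
  refine ContinuousOn.continuousAt (s := Ω) ?_ (hΩo.mem_nhds hz₀)
  rw [continuousOn_iff_continuous_domRestrict]
  have h2 : Ω.domRestrict (fun z : (C(U, ComplexTorus) × RealTorus) × ℂ =>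
      angularFun z.1.1 c e z.1.2 z.2) = fun z : Ω => circleExp (c (z.1.1.1 ⟨_, z.2⟩)) := by
    ext z
    exact dif_pos z.2
  rw [h2]
  refine continuous_circleExp.comp (hc.comp ?_)
  have h : Continuous fun z : Ω => (⟨_, z.2⟩ : U) := (hpos.comp continuous_subtype_val).subtype_mk _
  exact (continuous_fst.comp (continuous_fst.comp continuous_subtype_val)).eval h

theorem circleExp_ne_zero (x : AddCircle (1 : ℂ)) : circleExp x ≠ 0 := by
  induction x using QuotientAddGroup.induction_on with
  | H z => exact Complex.exp_ne_zero _

/-- Weierstrass: near `(F₀, x₀)` the angular functions are holomorphic on a common disc and converge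
locally uniformly there, so their derivatives at `0` converge. -/
theorem continuous_jacEntry (hUo : IsOpen U) (hUT : ∀ x, torusIncl x ∈ U)
    {c : ComplexTorus → AddCircle (1 : ℂ)} {l : ℂ × ℂ →L[ℂ] ℂ} (hc : Continuous c)
    (hcl : ∀ z, c (complexProj z) = (l z : AddCircle (1 : ℂ))) (e : ℂ × ℂ) :
    Continuous fun z : HamU U × RealTorus => jacEntry z.1.1 c e z.2 := by
  rw [continuous_iff_continuousAt]
  rintro ⟨F₀, x₀⟩
  have hzero : ∀ x : RealTorus, torusIncl x + complexProj ((0 : ℂ) • e) ∈ U := fun x => by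
    have : complexProj ((0 : ℂ) • e) = 0 := by rw [zero_smul]; rfl
    rw [this, add_zero]; exact hUT _
  have hpos : Continuous fun z : (HamU U × RealTorus) × ℂ =>
      torusIncl z.1.2 + complexProj (z.2 • e) :=
    (continuous_torusIncl.comp (by fun_prop)).add (continuous_complexProj.comp (by fun_prop))
  have hcomp : ∀ z : (HamU U × RealTorus) × ℂ, torusIncl z.1.2 + complexProj (z.2 • e) ∈ U →
      ContinuousAt (fun z : (HamU U × RealTorus) × ℂ => angularFun z.1.1.1 c e z.1.2 z.2) z := by
    intro z hz
    exact ContinuousAt.comp (g := fun z : (C(U, ComplexTorus) × RealTorus) × ℂ =>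
      angularFun z.1.1 c e z.1.2 z.2) (f := fun z : (HamU U × RealTorus) × ℂ =>
        ((z.1.1.1, z.1.2), z.2)) (continuousAt_angularFun hUo hc e hz) (by fun_prop)
  have hev : ∀ᶠ z in 𝓝 (F₀, x₀) ×ˢ 𝓝 (0 : ℂ),
      torusIncl z.1.2 + complexProj (z.2 • e) ∈ U := by
    rw [← nhds_prod_eq]
    exact hpos.continuousAt.eventually (hUo.mem_nhds (hzero x₀))
  -- A neighbourhood of `(F₀, x₀)` and a disc on which all the angular functions are defined.
  obtain ⟨pa, hpa, pb, hpb, hab⟩ := eventually_prod_iff.mp hev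
  obtain ⟨r, hr, hrb⟩ := Metric.eventually_nhds_iff_ball.mp hpb
  have hderiv : ContinuousAt (fun z : HamU U × RealTorus =>
      deriv (angularFun z.1.1 c e z.2) 0) (F₀, x₀) := by
    have h1 : TendstoLocallyUniformlyOn
        (fun z : HamU U × RealTorus => angularFun z.1.1 c e z.2)
        (angularFun F₀.1 c e x₀) (𝓝 (F₀, x₀)) (Metric.ball 0 r) := by
      rw [tendstoLocallyUniformlyOn_iff_forall_tendsto]
      intro w hw
      have hz : ContinuousAt (fun z : (HamU U × RealTorus) × ℂ =>
          angularFun z.1.1.1 c e z.1.2 z.2) ((F₀, x₀), w) :=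
        hcomp _ (hab hpa.self_of_nhds (hrb w hw))
      have hz1 : ContinuousAt (fun z : (HamU U × RealTorus) × ℂ =>
          angularFun F₀.1 c e x₀ z.2) ((F₀, x₀), w) :=
        ContinuousAt.comp (g := fun z : (HamU U × RealTorus) × ℂ =>
          angularFun z.1.1.1 c e z.1.2 z.2) (f := fun z : (HamU U × RealTorus) × ℂ =>
            ((F₀, x₀), z.2)) hz (by fun_prop)
      have h2 := (hz1.prodMk hz)
      have h3 : Tendsto (fun z : (HamU U × RealTorus) × ℂ =>
          (angularFun F₀.1 c e x₀ z.2, angularFun z.1.1.1 c e z.1.2 z.2))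
          (𝓝 (F₀, x₀) ×ˢ 𝓝[Metric.ball 0 r] w) (uniformity ℂ) := by
        refine Tendsto.mono_right (Tendsto.mono_left h2 ?_) (nhds_le_uniformity _)
        rw [nhds_prod_eq (x := (F₀, x₀)) (y := w)]
        exact Filter.prod_mono le_rfl nhdsWithin_le_nhds
      exact h3
    have h4 := (h1.deriv (hpa.mono fun z hz w hw =>
      (differentiableAt_angularFun z.1.2.1 hcl e z.2
        (hab hz (hrb w hw))).differentiableWithinAt) Metric.isOpen_ball)
    exact h4.tendsto_at (Metric.mem_ball_self hr)
  have hval : ContinuousAt (fun z : HamU U × RealTorus => angularFun z.1.1 c e z.2 0)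
      (F₀, x₀) :=
    ContinuousAt.comp (g := fun z : (HamU U × RealTorus) × ℂ =>
      angularFun z.1.1.1 c e z.1.2 z.2) (f := fun z : HamU U × RealTorus => (z, 0))
      (hcomp ((F₀, x₀), 0) (hzero x₀)) (continuous_id.prodMk continuous_const).continuousAt
  have hne : angularFun F₀.1 c e x₀ 0 ≠ 0 := by
    rw [angularFun, dif_pos (hzero x₀)]; exact circleExp_ne_zero _
  refine Complex.continuous_re.continuousAt.comp (hderiv.div (continuousAt_const.mul hval) ?_)
  simp [hne, Real.pi_ne_zero]

theorem continuous_torusJac (hUo : IsOpen U) (hUT : ∀ x, torusIncl x ∈ U) :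
    Continuous fun z : HamU U × RealTorus => torusJac z.1.1 z.2 := by
  have h1 := fun e => continuous_jacEntry hUo hUT continuous_fst
    (l := ContinuousLinearMap.fst ℂ ℂ ℂ) (fun _ => rfl) e
  have h2 := fun e => continuous_jacEntry hUo hUT continuous_snd
    (l := ContinuousLinearMap.snd ℂ ℂ ℂ) (fun _ => rfl) e
  exact continuous_ofColumns.comp (((h1 _).prodMk (h2 _)).prodMk ((h1 _).prodMk (h2 _)))

/-! ### Iterates -/

theorem continuous_iterate_realMap (hUo : IsOpen U) (hUT : ∀ x, torusIncl x ∈ U) (k : ℕ) :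
    Continuous fun z : HamU U × RealTorus => (realMap hUT z.1.1)^[k] z.2 := by
  induction k with
  | zero => exact continuous_snd
  | succ k ih =>
    simp only [Function.iterate_succ_apply']
    exact (continuous_realMap hUo hUT).comp
      ((continuous_subtype_val.comp continuous_fst).prodMk ih)

/-- The derivative of the `k`-th iterate of `F` along the real torus. -/
def torusJacIter (hUT : ∀ x, torusIncl x ∈ U) (F : U → ComplexTorus) :
    ℕ → RealTorus → (ℝ × ℝ →L[ℝ] ℝ × ℝ)
  | 0, _ => ContinuousLinearMap.id ℝ _
  | k + 1, x => torusJac F ((realMap hUT F)^[k] x) * torusJacIter hUT F k x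

theorem continuous_torusJacIter (hUo : IsOpen U) (hUT : ∀ x, torusIncl x ∈ U) (k : ℕ) :
    Continuous fun z : HamU U × RealTorus => torusJacIter hUT z.1.1 k z.2 := by
  induction k with
  | zero => exact continuous_const
  | succ k ih =>
    simp only [torusJacIter]
    exact ((continuous_torusJac hUo hUT).comp
      (continuous_fst.prodMk (continuous_iterate_realMap hUo hUT k))).mul ih

theorem torusJacIter_add (hUT : ∀ x, torusIncl x ∈ U) (F : U → ComplexTorus) (a b : ℕ)
    (x : RealTorus) : torusJacIter hUT F (a + b) x =
      torusJacIter hUT F a ((realMap hUT F)^[b] x) * torusJacIter hUT F b x := by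
  induction a with
  | zero => rw [zero_add]; exact (one_mul _).symm
  | succ a ih =>
    rw [Nat.add_right_comm, torusJacIter, torusJacIter, ih, ← Function.iterate_add_apply, mul_assoc]

theorem torusJacIter_mul (hUT : ∀ x, torusIncl x ∈ U) (F : U → ComplexTorus) {d : ℕ}
    {x : RealTorus} (hx : (realMap hUT F)^[d] x = x) (j : ℕ) :
    torusJacIter hUT F (d * j) x = torusJacIter hUT F d x ^ j := by
  induction j with
  | zero => rw [mul_zero, pow_zero]; rfl
  | succ j ih => rw [mul_add_one, torusJacIter_add, hx, ih, pow_succ]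

theorem hasFDerivAt_iterate_lift (hUT : ∀ x, torusIncl x ∈ U) {F : C(U, ComplexTorus)}
    (hF : F ∈ HamU U) {L : ℝ × ℝ → ℝ × ℝ} (hL : IsSmoothLift (realMap hUT F) L) (k : ℕ)
    (p : ℝ × ℝ) : HasFDerivAt L^[k] (torusJacIter hUT F k (realProj p)) p := by
  induction k with
  | zero => exact hasFDerivAt_id p
  | succ k ih =>
    rw [Function.iterate_succ', torusJacIter, ← (hL.iterate k).realProj_apply,
      torusJac_realProj hUT hF hL]
    exact (hL.differentiable _).hasFDerivAt.comp p ih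

theorem planeArea_torusJacIter (hUT : ∀ x, torusIncl x ∈ U) {F : C(U, ComplexTorus)}
    (hF : F ∈ HamU U) (k : ℕ) (x : RealTorus) (a b : ℝ × ℝ) :
    planeArea (torusJacIter hUT F k x a) (torusJacIter hUT F k x b) = planeArea a b := by
  obtain ⟨p, rfl⟩ := realProj_surjective x
  obtain ⟨L, hL⟩ := exists_isSmoothLift hUT hF
  exact (hL.iterate k).isAreaLift.planeArea_map (hasFDerivAt_iterate_lift hUT hF hL k p) a b

/-! ### Non-degeneracy in terms of the trace -/

/-- The trace of a linear map of the plane. -/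
def planeTrace (A : ℝ × ℝ →L[ℝ] ℝ × ℝ) : ℝ := (A (1, 0)).1 + (A (0, 1)).2

theorem continuous_planeTrace : Continuous planeTrace := by unfold planeTrace; fun_prop

theorem isComplexEigenvalue_iff {A : ℝ × ℝ →L[ℝ] ℝ × ℝ}
    (hA : planeArea (A (1, 0)) (A (0, 1)) = 1) (μ : ℂ) :
    IsComplexEigenvalue A μ ↔ μ ^ 2 - planeTrace A * μ + 1 = 0 := by
  unfold IsComplexEigenvalue
  rw [← LinearMap.charpoly_toMatrix _ (Module.Basis.finTwoProd ℝ), Matrix.charpoly_fin_two]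
  have ht : (LinearMap.toMatrix (Module.Basis.finTwoProd ℝ) (Module.Basis.finTwoProd ℝ)
      (A : ℝ × ℝ →ₗ[ℝ] ℝ × ℝ)).trace = planeTrace A := by
    simp [Matrix.trace_fin_two, LinearMap.toMatrix_apply, planeTrace]
  have hd : (LinearMap.toMatrix (Module.Basis.finTwoProd ℝ) (Module.Basis.finTwoProd ℝ)
      (A : ℝ × ℝ →ₗ[ℝ] ℝ × ℝ)).det = 1 := by
    rw [← hA, Matrix.det_fin_two]
    simp only [LinearMap.toMatrix_apply, planeArea]
    simp
    ring
  rw [ht, hd]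
  simp

/-- The eigenvalues are the roots of `μ² - tμ + 1`: a conjugate pair on the unit circle if `t² < 4`,
a real pair off it if `t² > 4`, and a double root `t / 2 = ±1` if `t² = 4`, which both alternatives
exclude. -/
theorem isHyperbolicMap_or_isEllipticMap_iff {A : ℝ × ℝ →L[ℝ] ℝ × ℝ}
    (hA : planeArea (A (1, 0)) (A (0, 1)) = 1) :
    IsHyperbolicMap A ∨ IsEllipticMap A ↔ planeTrace A ^ 2 ≠ 4 := by
  simp only [IsHyperbolicMap, IsEllipticMap, isComplexEigenvalue_iff hA]
  set t := planeTrace A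
  constructor
  · intro h ht
    have h1 : ((t / 2 : ℝ) : ℂ) ^ 2 - t * ((t / 2 : ℝ) : ℂ) + 1 = 0 := by
      have : (t / 2) ^ 2 - t * (t / 2) + 1 = 0 := by linear_combination (-1 / 4 : ℝ) * ht
      exact_mod_cast this
    rcases h with h | h
    · refine h _ h1 ?_
      rw [Complex.norm_real, Real.norm_eq_abs, ← sq_eq_sq₀ (abs_nonneg _) zero_le_one, sq_abs]
      linear_combination (1 / 4 : ℝ) * ht
    · exact (h _ h1).2 (Complex.ofReal_im _)
  · intro ht
    have hsplit : ∀ μ : ℂ, μ ^ 2 - t * μ + 1 = 0 →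
        μ.re ^ 2 - μ.im ^ 2 - t * μ.re + 1 = 0 ∧ μ.im * (2 * μ.re - t) = 0 := by
      intro μ h
      have h1 := congrArg Complex.re h
      have h2 := congrArg Complex.im h
      simp [pow_two] at h1 h2
      exact ⟨by linear_combination h1, by linear_combination h2⟩
    have hnorm : ∀ μ : ℂ, ‖μ‖ = 1 ↔ μ.re ^ 2 + μ.im ^ 2 = 1 := by
      intro μ
      rw [← sq_eq_sq₀ (norm_nonneg _) zero_le_one, Complex.sq_norm, Complex.normSq_apply]
      ring_nf
    rcases lt_or_gt_of_ne ht with ht | ht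
    · right
      intro μ hμ
      obtain ⟨h1, h2⟩ := hsplit μ hμ
      have him : μ.im ≠ 0 := by
        intro h0
        rw [h0] at h1
        nlinarith [sq_nonneg (2 * μ.re - t)]
      refine ⟨?_, him⟩
      have h3 : 2 * μ.re - t = 0 := (mul_eq_zero.mp h2).resolve_left him
      rw [hnorm]
      linear_combination -h1 + μ.re * h3
    · left
      intro μ hμ h
      rw [hnorm] at h
      obtain ⟨h1, h2⟩ := hsplit μ hμ
      rcases mul_eq_zero.mp h2 with h0 | h0
      · have h3 : μ.re ^ 2 = 1 := by rw [h0] at h; linarith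
        have h4 : t * μ.re = 2 := by rw [h0] at h1; linarith
        have : t ^ 2 = 4 := by
          have : (t * μ.re) ^ 2 = 4 := by rw [h4]; norm_num
          rw [mul_pow, h3, mul_one] at this
          exact this
        linarith
      · have : t = 2 * μ.re := by linarith
        rw [this] at ht
        nlinarith [sq_nonneg μ.im]

theorem isNonDegenerate_realMap_iff (hUT : ∀ x, torusIncl x ∈ U) {F : C(U, ComplexTorus)}
    (hF : F ∈ HamU U) (k : ℕ) (x : RealTorus) :
    IsNonDegenerate (realMap hUT F) k x ↔ planeTrace (torusJacIter hUT F k x) ^ 2 ≠ 4 := by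
  obtain ⟨L, hL⟩ := exists_isSmoothLift hUT hF
  have hA : planeArea (torusJacIter hUT F k x (1, 0)) (torusJacIter hUT F k x (0, 1)) = 1 := by
    rw [planeArea_torusJacIter hUT hF]; simp [planeArea]
  rw [← isHyperbolicMap_or_isEllipticMap_iff hA]
  constructor
  · rintro ⟨A, hA, h⟩
    obtain ⟨p, rfl, hp⟩ := (hL.iterate k).exists_hasFDerivAt hA
    rwa [← hp.unique (hasFDerivAt_iterate_lift hUT hF hL k p)]
  · intro h
    obtain ⟨p, rfl⟩ := realProj_surjective x
    exact ⟨_, (hL.iterate k).hasTorusDerivAt (hasFDerivAt_iterate_lift hUT hF hL k p), h⟩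

/-- A closed condition on the derivatives at points of period `d` fails to have solutions for an
open set of maps. -/
theorem isOpen_setOf_forall_notMem (hUo : IsOpen U) (hUT : ∀ x, torusIncl x ∈ U) (d : ℕ)
    {B : Set (ℝ × ℝ →L[ℝ] ℝ × ℝ)} (hB : IsClosed B) :
    IsOpen {F : HamU U | ∀ x, (realMap hUT F.1)^[d] x = x → torusJacIter hUT F.1 d x ∉ B} := by
  have hc : IsClosed {z : HamU U × RealTorus | (realMap hUT z.1.1)^[d] z.2 = z.2 ∧
      torusJacIter hUT z.1.1 d z.2 ∈ B} :=
    (isClosed_eq (continuous_iterate_realMap hUo hUT d) continuous_snd).inter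
      (hB.preimage (continuous_torusJacIter hUo hUT d))
  -- The torus is compact, so the set of maps having a bad point is closed.
  have h2 := isClosedMap_fst_of_compactSpace _ hc
  convert h2.isOpen_compl using 1
  ext F
  simp

end

noncomputable section

/-! ### Hamiltonian vector fields on the plane and their jets -/

/-- The linear map taking the differential of a function to its Hamiltonian vector. -/
def symplGrad : (ℝ × ℝ →L[ℝ] ℝ) →L[ℝ] ℝ × ℝ :=
  (ContinuousLinearMap.apply ℝ ℝ ((0, 1) : ℝ × ℝ)).prod
    (-ContinuousLinearMap.apply ℝ ℝ ((1, 0) : ℝ × ℝ))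

theorem symplGrad_apply (ξ : ℝ × ℝ →L[ℝ] ℝ) : symplGrad ξ = (ξ (0, 1), -ξ (1, 0)) := rfl

/-- The Hamiltonian vector field of a function on the plane. -/
def hamField (H : ℝ × ℝ → ℝ) (p : ℝ × ℝ) : ℝ × ℝ := symplGrad (fderiv ℝ H p)

/-- The derivative of the Hamiltonian vector field. -/
def hamFieldDeriv (H : ℝ × ℝ → ℝ) (p : ℝ × ℝ) : ℝ × ℝ →L[ℝ] ℝ × ℝ :=
  symplGrad.comp (fderiv ℝ (fderiv ℝ H) p)

/-- The action of the Hamiltonian vector field on first order jets of maps. -/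
def jetField (H : ℝ × ℝ → ℝ) (z : (ℝ × ℝ) × (ℝ × ℝ →L[ℝ] ℝ × ℝ)) :
    (ℝ × ℝ) × (ℝ × ℝ →L[ℝ] ℝ × ℝ) :=
  (hamField H z.1, (hamFieldDeriv H z.1).comp z.2)

theorem hasFDerivAt_hamField {H : ℝ × ℝ → ℝ} (hH : ContDiff ℝ 2 H) (p : ℝ × ℝ) :
    HasFDerivAt (hamField H) (hamFieldDeriv H p) p :=
  symplGrad.hasFDerivAt.comp p
    ((hH.fderiv_right (m := 1) (by norm_num)).differentiable (by norm_num) p).hasFDerivAt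

theorem contDiff_jetField {H : ℝ × ℝ → ℝ} (hH : ContDiff ℝ 3 H) : ContDiff ℝ 1 (jetField H) := by
  have h1 : ContDiff ℝ 1 (fderiv ℝ H) := hH.fderiv_right (by norm_num)
  have h2 : ContDiff ℝ 2 (fderiv ℝ H) := hH.fderiv_right (by norm_num)
  have h3 : ContDiff ℝ 1 (fderiv ℝ (fderiv ℝ H)) := h2.fderiv_right (by norm_num)
  exact (symplGrad.contDiff.comp (h1.comp contDiff_fst)).prodMk
    ((contDiff_const.clm_comp (h3.comp contDiff_fst)).clm_comp contDiff_snd)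

/-! ### Compositions of kicks -/

section Kick

variable {ι E : Type*} [NormedAddCommGroup E] [NormedSpace ℝ E]

/-- The composition of the maps `z ↦ z + ε i • Y i z` along a list. -/
def kick (Y : ι → E → E) : List ι → (ι → ℝ) → E → E
  | [], _, z => z
  | i :: l, ε, z => kick Y l ε z + ε i • Y i (kick Y l ε z)

theorem kick_zero (Y : ι → E → E) (l : List ι) (z : E) : kick Y l 0 z = z := by
  induction l with
  | nil => rfl
  | cons i l ih => simp [kick, ih]

variable [Fintype ι]

theorem contDiff_kick {Y : ι → E → E} (hY : ∀ i, ContDiff ℝ 1 (Y i)) (l : List ι) :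
    ContDiff ℝ 1 fun q : (ι → ℝ) × E => kick Y l q.1 q.2 := by
  induction l with
  | nil => exact contDiff_snd
  | cons i l ih =>
    exact ih.add (((contDiff_apply ℝ ℝ i).comp contDiff_fst).smul ((hY i).comp ih))

/-- At `ε = 0` every factor is the identity, so to first order the kicks add up and their order is
irrelevant. -/
theorem fderiv_kick {Y : ι → E → E} (hY : ∀ i, ContDiff ℝ 1 (Y i)) (l : List ι) (z w : E)
    (v : ι → ℝ) : fderiv ℝ (fun q : (ι → ℝ) × E => kick Y l q.1 q.2) (0, z) (v, w) =
      w + (l.map fun i => v i • Y i z).sum := by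
  induction l with
  | nil =>
    simp only [kick, List.map_nil, List.sum_nil, add_zero]
    rw [fderiv_snd]; rfl
  | cons i l ih =>
    have h1 : HasFDerivAt (fun q : (ι → ℝ) × E => kick Y l q.1 q.2)
        (fderiv ℝ (fun q : (ι → ℝ) × E => kick Y l q.1 q.2) (0, z)) (0, z) :=
      ((contDiff_kick hY l).differentiable (by norm_num) _).hasFDerivAt
    have h2 : HasFDerivAt (Y i) (fderiv ℝ (Y i) z) (kick Y l (0 : ι → ℝ) z) := by
      rw [kick_zero]; exact ((hY i).differentiable (by norm_num) _).hasFDerivAt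
    have h3 : HasFDerivAt (fun q : (ι → ℝ) × E => q.1 i)
        ((ContinuousLinearMap.proj i).comp (ContinuousLinearMap.fst ℝ (ι → ℝ) E)) (0, z) :=
      ((ContinuousLinearMap.proj (R := ℝ) (φ := fun _ : ι => ℝ) i).comp
        (ContinuousLinearMap.fst ℝ (ι → ℝ) E)).hasFDerivAt
    have h4 : HasFDerivAt (fun q : (ι → ℝ) × E => kick Y (i :: l) q.1 q.2) _ (0, z) :=
      h1.add (h3.smul (HasFDerivAt.comp (f := fun q : (ι → ℝ) × E => kick Y l q.1 q.2)
        ((0, z) : (ι → ℝ) × E) h2 h1))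
    rw [h4.fderiv]
    simp [ih, kick_zero]
    abel

theorem contDiff_iterate_kick {Y : ι → E → E} (hY : ∀ i, ContDiff ℝ 1 (Y i)) (l : List ι)
    {T : E → E} (hT : ContDiff ℝ 1 T) (d : ℕ) : ContDiff ℝ 1
      (fun q : (ι → ℝ) × E => (fun z => kick Y l q.1 (T z))^[d] q.2) := by
  induction d with
  | zero => exact contDiff_snd
  | succ d ih =>
    simp only [Function.iterate_succ_apply']
    exact (contDiff_kick hY l).comp (contDiff_fst.prodMk (hT.comp ih))

/-- Variation of the iterates of `z ↦ kick Y l ε (T z)` with the parameter: only the kicks along the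
orbit contribute, and here they all vanish but the last. -/
theorem fderiv_iterate_kick {Y : ι → E → E} (hY : ∀ i, ContDiff ℝ 1 (Y i)) (l : List ι)
    {T : E → E} (hT : ContDiff ℝ 1 T) (d : ℕ) (z : E) {v : ι → ℝ}
    (hv : ∀ j, j < d → (l.map fun i => v i • Y i (T^[j + 1] z)).sum = 0) :
    fderiv ℝ (fun q : (ι → ℝ) × E => (fun z => kick Y l q.1 (T z))^[d + 1] q.2) (0, z) (v, 0) =
      (l.map fun i => v i • Y i (T^[d + 1] z)).sum := by
  have h0 : ∀ d, (fun z => kick Y l (0 : ι → ℝ) (T z))^[d] z = T^[d] z := by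
    intro d
    congr 1
    ext1 z
    rw [kick_zero]
  -- If the variation vanishes after `d` steps, the next one consists of the kick at the new point
  -- alone.
  have hstep : ∀ d, fderiv ℝ (fun q : (ι → ℝ) × E => (fun z => kick Y l q.1 (T z))^[d] q.2)
        (0, z) (v, 0) = 0 →
      fderiv ℝ (fun q : (ι → ℝ) × E => (fun z => kick Y l q.1 (T z))^[d + 1] q.2) (0, z) (v, 0) =
        (l.map fun i => v i • Y i (T^[d + 1] z)).sum := by
    intro d hd
    simp only [Function.iterate_succ_apply']
    set Θ : (ι → ℝ) × E → E := fun q => (fun z => kick Y l q.1 (T z))^[d] q.2 with hΘ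
    have hΘ0 : Θ (0, z) = T^[d] z := h0 d
    have h1 : HasFDerivAt Θ (fderiv ℝ Θ (0, z)) (0, z) :=
      ((contDiff_iterate_kick hY l hT d).differentiable (by norm_num) _).hasFDerivAt
    have h2 : HasFDerivAt T (fderiv ℝ T (T^[d] z)) (Θ (0, z)) := by
      rw [hΘ0]; exact (hT.differentiable (by norm_num) _).hasFDerivAt
    have h3 := (hasFDerivAt_fst (𝕜 := ℝ) (p := ((0 : ι → ℝ), z))).prodMk (h2.comp (0, z) h1)
    have h4 : HasFDerivAt (fun q : (ι → ℝ) × E => kick Y l q.1 q.2)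
        (fderiv ℝ (fun q : (ι → ℝ) × E => kick Y l q.1 q.2) (0, T (T^[d] z)))
        (((0, z) : (ι → ℝ) × E).1, (T ∘ Θ) (0, z)) := by
      rw [Function.comp_apply, hΘ0]
      exact ((contDiff_kick hY l).differentiable (by norm_num) _).hasFDerivAt
    have h5 : HasFDerivAt (fun q : (ι → ℝ) × E => kick Y l q.1 (T (Θ q))) _ (0, z) :=
      HasFDerivAt.comp (f := fun q : (ι → ℝ) × E => (q.1, (T ∘ Θ) q)) (0, z) h4 h3
    rw [h5.fderiv]
    simp [hd, fderiv_kick hY]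
  have hzero : ∀ j, j ≤ d → fderiv ℝ
      (fun q : (ι → ℝ) × E => (fun z => kick Y l q.1 (T z))^[j] q.2) (0, z) (v, 0) = 0 := by
    intro j
    induction j with
    | zero =>
      intro _
      simp only [Function.iterate_zero, id]
      rw [fderiv_snd]; rfl
    | succ j ih =>
      intro hj
      rw [hstep j (ih (by omega)), hv j hj]
  exact hstep d (hzero d le_rfl)

end Kick

/-! ### First order jets of kicked maps -/

/-- `z` is the first order jet of `u` at `p`. -/
def IsJetAt (u : ℝ × ℝ → ℝ × ℝ) (p : ℝ × ℝ) (z : (ℝ × ℝ) × (ℝ × ℝ →L[ℝ] ℝ × ℝ)) : Prop :=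
  z.1 = u p ∧ HasFDerivAt u z.2 p

/-- The action of a map on first order jets. -/
def jetMap (L : ℝ × ℝ → ℝ × ℝ) (z : (ℝ × ℝ) × (ℝ × ℝ →L[ℝ] ℝ × ℝ)) :
    (ℝ × ℝ) × (ℝ × ℝ →L[ℝ] ℝ × ℝ) := (L z.1, (fderiv ℝ L z.1).comp z.2)

theorem contDiff_jetMap {L : ℝ × ℝ → ℝ × ℝ} (hL : ContDiff ℝ 2 L) : ContDiff ℝ 1 (jetMap L) := by
  have h1 : ContDiff ℝ 1 L := hL.of_le (by norm_num)
  have h2 : ContDiff ℝ 1 (fderiv ℝ L) := hL.fderiv_right (by norm_num)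
  exact (h1.comp contDiff_fst).prodMk ((h2.comp contDiff_fst).clm_comp contDiff_snd)

namespace IsJetAt

variable {u : ℝ × ℝ → ℝ × ℝ} {p : ℝ × ℝ} {z : (ℝ × ℝ) × (ℝ × ℝ →L[ℝ] ℝ × ℝ)}

theorem jetMap {L : ℝ × ℝ → ℝ × ℝ} (hL : Differentiable ℝ L) (h : IsJetAt u p z) :
    IsJetAt (L ∘ u) p (jetMap L z) := by
  refine ⟨congrArg L h.1, ?_⟩
  simp only [_root_.jetMap]
  rw [h.1]
  exact (hL _).hasFDerivAt.comp p h.2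

/-- Differentiating `u + ε X(u)` gives `A + ε DX ∘ A`. Kicks therefore act on jets as kicks along
`jetField`, and one scheme controls the point and the derivative together. -/
theorem kick {ι : Type*} {H : ι → ℝ × ℝ → ℝ} (hH : ∀ i, ContDiff ℝ 3 (H i)) (l : List ι)
    (ε : ι → ℝ) (h : IsJetAt u p z) :
    IsJetAt (fun q => kick (fun i => hamField (H i)) l ε (u q)) p
      (kick (fun i => jetField (H i)) l ε z) := by
  induction l with
  | nil => exact h
  | cons i l ih =>
    refine ⟨?_, ?_⟩
    · simp only [_root_.kick, Prod.fst_add, Prod.smul_fst, ih.1, jetField]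
    · have := (hasFDerivAt_hamField ((hH i).of_le (by norm_num)) _).comp p ih.2
      have h2 := ih.2.add (this.const_smul (ε i))
      simp only [_root_.kick, Prod.snd_add, Prod.smul_snd, ih.1, jetField]
      exact h2

theorem iterate_kick {ι : Type*} {H : ι → ℝ × ℝ → ℝ} (hH : ∀ i, ContDiff ℝ 3 (H i)) (l : List ι)
    (ε : ι → ℝ) {L : ℝ × ℝ → ℝ × ℝ} (hL : Differentiable ℝ L) (d : ℕ) (p : ℝ × ℝ) :
    IsJetAt (fun q => _root_.kick (fun i => hamField (H i)) l ε (L q))^[d] p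
      ((fun z => _root_.kick (fun i => jetField (H i)) l ε (_root_.jetMap L z))^[d]
        (p, ContinuousLinearMap.id ℝ _)) := by
  induction d with
  | zero => exact ⟨rfl, hasFDerivAt_id p⟩
  | succ d ih =>
    rw [Function.iterate_succ', Function.iterate_succ_apply']
    exact (ih.jetMap hL).kick hH l ε

end IsJetAt

/-! ### Plane waves and their shears -/

/-- The plane wave `cos (2π(ax + by) + θ)` with `w = (a, b, θ)`. -/
def wave (w : ℤ × ℤ × ℝ) (p : ℝ × ℝ) : ℝ :=
  Real.cos (2 * Real.pi * (w.1 * p.1 + w.2.1 * p.2) + w.2.2)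

theorem contDiff_wave (w : ℤ × ℤ × ℝ) {n : WithTop ℕ∞} : ContDiff ℝ n (wave w) := by
  unfold wave; fun_prop

theorem hasFDerivAt_wave (w : ℤ × ℤ × ℝ) (p : ℝ × ℝ) : HasFDerivAt (wave w)
    (-(2 * Real.pi * Real.sin (2 * Real.pi * (w.1 * p.1 + w.2.1 * p.2) + w.2.2)) •
      ((w.1 : ℝ) • ContinuousLinearMap.fst ℝ ℝ ℝ + (w.2.1 : ℝ) • ContinuousLinearMap.snd ℝ ℝ ℝ))
    p := by
  have h : HasFDerivAt (fun p : ℝ × ℝ => 2 * Real.pi * (w.1 * p.1 + w.2.1 * p.2) + w.2.2)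
      ((2 * Real.pi) • ((w.1 : ℝ) • ContinuousLinearMap.fst ℝ ℝ ℝ +
        (w.2.1 : ℝ) • ContinuousLinearMap.snd ℝ ℝ ℝ)) p :=
    (((hasFDerivAt_fst.const_mul _).add (hasFDerivAt_snd.const_mul _)).const_mul _).add_const _
  refine h.cos.congr_fderiv ?_
  rw [smul_smul]
  congr 1
  ring

theorem hamField_wave (w : ℤ × ℤ × ℝ) (p : ℝ × ℝ) : hamField (wave w) p =
    (-(2 * Real.pi * Real.sin (2 * Real.pi * (w.1 * p.1 + w.2.1 * p.2) + w.2.2))) •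
      ((w.2.1 : ℝ), -(w.1 : ℝ)) := by
  rw [hamField, (hasFDerivAt_wave w p).fderiv, symplGrad_apply]
  simp

theorem wave_eq_of_realProj_eq (w : ℤ × ℤ × ℝ) {p q : ℝ × ℝ} (h : realProj p = realProj q) :
    wave w p = wave w q := by
  obtain ⟨m, k, rfl⟩ := realProj_eq_iff.mp h
  unfold wave
  rw [← Real.cos_add_int_mul_two_pi (2 * Real.pi * (w.1 * q.1 + w.2.1 * q.2) + w.2.2)
    (w.1 * m + w.2.1 * k)]
  congr 1
  push_cast [Prod.fst_add, Prod.snd_add]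
  ring

theorem hamField_wave_add_int (w : ℤ × ℤ × ℝ) (p : ℝ × ℝ) (m k : ℤ) :
    hamField (wave w) (p + ((m : ℝ), (k : ℝ))) = hamField (wave w) p := by
  rw [hamField, hamField, ← fderiv_comp_add_right]
  congr 2
  ext1 q
  exact wave_eq_of_realProj_eq w (realProj_add_int q m k)

/-- The shear of the plane generated by a plane wave. -/
def planeShear (w : ℤ × ℤ × ℝ) (s : ℝ) (p : ℝ × ℝ) : ℝ × ℝ := p + s • hamField (wave w) p

/-- The field is tangent to the level lines of the phase, hence constant along its own trajectories.
The kick `p + s X(p)` is thus the exact time-`s` flow and not just an approximation to it. -/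
theorem hamField_planeShear (w : ℤ × ℤ × ℝ) (s : ℝ) (p : ℝ × ℝ) :
    hamField (wave w) (planeShear w s p) = hamField (wave w) p := by
  rw [hamField_wave w (planeShear w s p), hamField_wave w p]
  congr 5
  simp only [planeShear, hamField_wave, Prod.fst_add, Prod.snd_add, Prod.smul_fst, Prod.smul_snd,
    smul_eq_mul]
  ring

/-- The shear of the real torus generated by a plane wave. -/
def torusShear (w : ℤ × ℤ × ℝ) (s : ℝ) (x : RealTorus) : RealTorus :=
  realProj (planeShear w s (Function.surjInv realProj_surjective x))

theorem torusShear_realProj (w : ℤ × ℤ × ℝ) (s : ℝ) (p : ℝ × ℝ) :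
    torusShear w s (realProj p) = realProj (planeShear w s p) := by
  obtain ⟨m, k, h⟩ := realProj_eq_iff.mp
    (Function.surjInv_eq realProj_surjective (realProj p))
  rw [torusShear, h]
  simp only [planeShear, hamField_wave_add_int]
  rw [add_right_comm, realProj_add_int]

theorem planeShear_isHamFlow (w : ℤ × ℤ × ℝ) (s : ℝ) :
    ∃ H : ℝ → RealTorus → ℝ,
      AnalyticOnNhd ℝ (fun q : ℝ × (ℝ × ℝ) => H q.1 (realProj q.2)) univ ∧
      ∀ p t, HasDerivAt (fun t => planeShear w (t * s) p)
        (hamVectorField H t (planeShear w (t * s) p)) t := by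
  set H : ℝ → RealTorus → ℝ := fun _ x => s * wave w (Function.surjInv realProj_surjective x)
  have hH : ∀ t p, H t (realProj p) = s * wave w p := fun t p => by
    simp only [H]
    rw [wave_eq_of_realProj_eq w (Function.surjInv_eq realProj_surjective (realProj p))]
  refine ⟨H, ?_, fun p t => ?_⟩
  · simp only [hH]
    -- At order `⊤` this is analyticity.
    have : ContDiff ℝ ⊤ fun q : ℝ × (ℝ × ℝ) => s * wave w q.2 :=
      contDiff_const.mul ((contDiff_wave w).comp contDiff_snd)
    intro q _
    exact (this.contDiffAt).analyticAt
  · have h1 : ∀ q, hamVectorField H t q = s • hamField (wave w) q := by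
      intro q
      have hw := (hasFDerivAt_wave w q)
      have ha : HasDerivAt (fun y : ℝ => ((q.1, y) : ℝ × ℝ)) (0, 1) q.2 :=
        (hasDerivAt_const _ _).prodMk (hasDerivAt_id _)
      have hb : HasDerivAt (fun x : ℝ => ((x, q.2) : ℝ × ℝ)) (1, 0) q.1 :=
        (hasDerivAt_id _).prodMk (hasDerivAt_const _ _)
      have ha' := (HasFDerivAt.comp_hasDerivAt (f := fun y : ℝ => ((q.1, y) : ℝ × ℝ))
        q.2 hw ha).const_mul s
      have hb' := (HasFDerivAt.comp_hasDerivAt (f := fun x : ℝ => ((x, q.2) : ℝ × ℝ))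
        q.1 hw hb).const_mul s
      simp only [hamVectorField, hH]
      rw [hamField, hw.fderiv, symplGrad_apply]
      ext
      · exact ha'.deriv
      · simp only [Prod.smul_snd, smul_neg]
        exact congrArg Neg.neg hb'.deriv
    rw [h1, hamField_planeShear]
    have := (((hasDerivAt_id t).mul_const s).smul_const (hamField (wave w) p)).const_add p
    simpa [planeShear] using this

theorem isHamDiffeo_torusShear (w : ℤ × ℤ × ℝ) (s : ℝ) : IsHamDiffeo (torusShear w s) := by
  obtain ⟨H, hH, hφ⟩ := planeShear_isHamFlow w s
  exact .timeOne ⟨H, fun t p => planeShear w (t * s) p, hH, by simp [planeShear], hφ,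
    fun p => by simp [torusShear_realProj]⟩

theorem isSmoothLift_planeShear (w : ℤ × ℤ × ℝ) (s : ℝ) :
    IsSmoothLift (torusShear w s) (planeShear w s) where
  isAreaLift := by
    obtain ⟨H, hH, hφ⟩ := planeShear_isHamFlow w s
    have := isAreaLift_hamFlow (φ := fun t p => planeShear w (t * s) p) hH
      (by simp [planeShear]) hφ
    simpa using this
  realProj_apply p := (torusShear_realProj w s p).symm
  contDiff := by
    unfold planeShear
    simp only [hamField_wave]
    fun_prop

/-! ### Shears of the complexified torus and perturbations inside `HamU` -/

/-- The complexification of `planeShear`. -/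
def complexShear (w : ℤ × ℤ × ℝ) (s : ℝ) (z : ℂ × ℂ) : ℂ × ℂ :=
  z + ((s : ℂ) * (-(2 * Real.pi * Complex.sin (2 * Real.pi * (w.1 * z.1 + w.2.1 * z.2) + w.2.2))))
    • ((w.2.1 : ℂ), -(w.1 : ℂ))

theorem complexProj_eq_iff {p q : ℂ × ℂ} :
    complexProj p = complexProj q ↔ ∃ m k : ℤ, p = q + ((m : ℂ), (k : ℂ)) := by
  constructor
  · intro h
    have h1 : ((p.1 : ℂ) : AddCircle (1 : ℂ)) = q.1 := congrArg Prod.fst h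
    have h2 : ((p.2 : ℂ) : AddCircle (1 : ℂ)) = q.2 := congrArg Prod.snd h
    obtain ⟨m, hm⟩ := QuotientAddGroup.eq_iff_sub_mem.mp h1
    obtain ⟨k, hk⟩ := QuotientAddGroup.eq_iff_sub_mem.mp h2
    refine ⟨m, k, ?_⟩
    simp only [zsmul_eq_mul, mul_one] at hm hk
    ext <;> simp [hm, hk]
  · rintro ⟨m, k, rfl⟩
    have h : ∀ m : ℤ, ((m : ℂ) : AddCircle (1 : ℂ)) = 0 := fun m => by
      rw [AddCircle.coe_eq_zero_iff]; exact ⟨m, by simp⟩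
    simp only [complexProj, Prod.fst_add, Prod.snd_add, AddCircle.coe_add, h, add_zero]

theorem complexShear_add_int (w : ℤ × ℤ × ℝ) (s : ℝ) (z : ℂ × ℂ) (m k : ℤ) :
    complexShear w s (z + ((m : ℂ), (k : ℂ))) = complexShear w s z + ((m : ℂ), (k : ℂ)) := by
  have : Complex.sin (2 * Real.pi * (w.1 * (z.1 + m) + w.2.1 * (z.2 + k)) + w.2.2) =
      Complex.sin (2 * Real.pi * (w.1 * z.1 + w.2.1 * z.2) + w.2.2) := by
    rw [← Complex.sin_add_int_mul_two_pi (2 * Real.pi * (w.1 * z.1 + w.2.1 * z.2) + w.2.2)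
      (w.1 * m + w.2.1 * k)]
    congr 1
    push_cast
    ring
  simp only [complexShear, Prod.fst_add, Prod.snd_add, this]
  rw [add_right_comm]

/-- The shear of the complexified torus generated by a plane wave. -/
def complexTorusShear (w : ℤ × ℤ × ℝ) (s : ℝ) (x : ComplexTorus) : ComplexTorus :=
  complexProj (complexShear w s (Function.surjInv complexProj_surjective x))

theorem complexTorusShear_complexProj (w : ℤ × ℤ × ℝ) (s : ℝ) (z : ℂ × ℂ) :
    complexTorusShear w s (complexProj z) = complexProj (complexShear w s z) := by
  obtain ⟨m, k, h⟩ := complexProj_eq_iff.mp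
    (Function.surjInv_eq complexProj_surjective (complexProj z))
  rw [complexTorusShear, h, complexShear_add_int]
  exact complexProj_eq_iff.mpr ⟨m, k, rfl⟩

theorem continuous_complexTorusShear (w : ℤ × ℤ × ℝ) :
    Continuous fun q : ℝ × ComplexTorus => complexTorusShear w q.1 q.2 := by
  have hq : IsOpenQuotientMap (Prod.map id complexProj : ℝ × (ℂ × ℂ) → ℝ × ComplexTorus) :=
    IsOpenQuotientMap.id.prodMap isOpenQuotientMap_complexProj
  rw [hq.isQuotientMap.continuous_iff]
  have : (fun q : ℝ × ComplexTorus => complexTorusShear w q.1 q.2) ∘ Prod.map id complexProj =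
      fun q : ℝ × (ℂ × ℂ) => complexProj (complexShear w q.1 q.2) := by
    ext1 q
    exact complexTorusShear_complexProj w q.1 q.2
  rw [this]
  refine continuous_complexProj.comp ?_
  unfold complexShear
  fun_prop

theorem complexTorusShear_torusIncl (w : ℤ × ℤ × ℝ) (s : ℝ) (x : RealTorus) :
    complexTorusShear w s (torusIncl x) = torusIncl (torusShear w s x) := by
  obtain ⟨p, rfl⟩ := realProj_surjective x
  rw [torusShear_realProj, torusIncl_realProj, torusIncl_realProj, complexTorusShear_complexProj]
  congr 1
  simp only [complexShear, planeShear, hamField_wave, planeIncl_apply]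
  ext <;> push_cast [Prod.fst_add, Prod.snd_add, Prod.smul_fst, Prod.smul_snd, smul_eq_mul] <;> ring

/-- The shear of the complexified torus as a continuous map. -/
def shearMap (w : ℤ × ℤ × ℝ) (s : ℝ) : C(ComplexTorus, ComplexTorus) :=
  ⟨complexTorusShear w s, (continuous_complexTorusShear w).comp (continuous_const.prodMk continuous_id)⟩

theorem continuous_shearMap (w : ℤ × ℤ × ℝ) : Continuous (shearMap w) :=
  ContinuousMap.continuous_of_continuous_uncurry _ (continuous_complexTorusShear w)

variable {U : Set ComplexTorus} {ι : Type*}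

/-- The composition of a map with a finite sequence of shears. -/
def perturb (W : ι → ℤ × ℤ × ℝ) (F : C(U, ComplexTorus)) :
    List ι → (ι → ℝ) → C(U, ComplexTorus)
  | [], _ => F
  | i :: l, ε => (shearMap (W i) (ε i)).comp (perturb W F l ε)

theorem continuous_perturb (W : ι → ℤ × ℤ × ℝ) (F : C(U, ComplexTorus)) (l : List ι) :
    Continuous (perturb W F l) := by
  induction l with
  | nil => exact continuous_const
  | cons i l ih =>
    exact ((continuous_shearMap (W i)).comp (continuous_apply i)).compCM ih

theorem perturb_zero (W : ι → ℤ × ℤ × ℝ) (F : C(U, ComplexTorus)) (l : List ι) :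
    perturb W F l 0 = F := by
  induction l with
  | nil => rfl
  | cons i l ih =>
    ext1 u
    obtain ⟨z, hz⟩ := complexProj_surjective (F u)
    simp only [perturb, ih, ContinuousMap.comp_apply]
    rw [← hz]
    change complexTorusShear _ _ _ = _
    rw [complexTorusShear_complexProj]
    simp [complexShear]

theorem isHolomorphicOnTorus_shear {F : U → ComplexTorus} (hF : IsHolomorphicOnTorus F)
    (w : ℤ × ℤ × ℝ) (s : ℝ) : IsHolomorphicOnTorus fun u => complexTorusShear w s (F u) := by
  intro z hz
  obtain ⟨g, hg, hFg⟩ := hF z hz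
  refine ⟨fun v => complexShear w s (g v), ?_, ?_⟩
  · have h2 : AnalyticAt ℂ (complexShear w s) (g z) := by
      have h3 : ContDiff ℂ ⊤ (complexShear w s) := by unfold complexShear; fun_prop
      exact h3.contDiffAt.analyticAt
    exact h2.comp hg
  · filter_upwards [hFg] with v hv
    obtain ⟨hv, h⟩ := hv
    exact ⟨hv, by rw [h, complexTorusShear_complexProj]⟩

/-- The shears act after `F` and are defined on the whole complexified torus, so the perturbed map
is still holomorphic on the same `U`. -/
theorem perturb_spec (hUT : ∀ x, torusIncl x ∈ U) (W : ι → ℤ × ℤ × ℝ) {F : C(U, ComplexTorus)}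
    (hF : F ∈ HamU U) {L : ℝ × ℝ → ℝ × ℝ} (hL : IsSmoothLift (realMap hUT F) L) (l : List ι)
    (ε : ι → ℝ) : perturb W F l ε ∈ HamU U ∧
      IsSmoothLift (realMap hUT (perturb W F l ε))
        (fun p => kick (fun i => hamField (wave (W i))) l ε (L p)) := by
  induction l with
  | nil => exact ⟨hF, hL⟩
  | cons i l ih =>
    obtain ⟨h1, h2⟩ := ih
    have hE : Extends (perturb W F (i :: l) ε)
        (torusShear (W i) (ε i) ∘ realMap hUT (perturb W F l ε)) := by
      intro x hx
      change complexTorusShear _ _ (perturb W F l ε ⟨torusIncl x, hx⟩) = _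
      rw [extends_realMap hUT h1 x hx, complexTorusShear_torusIncl]
      rfl
    refine ⟨⟨isHolomorphicOnTorus_shear h1.1 (W i) (ε i), _,
      (isHamDiffeo_torusShear _ _).comp (isHamDiffeo_realMap hUT h1), hE⟩, ?_⟩
    rw [hE.realMap_eq hUT]
    exact (isSmoothLift_planeShear (W i) (ε i)).comp h2

end

noncomputable section

/-! ### Trigonometric polynomials of bounded degree -/

/-- The trigonometric polynomials of degree at most `N` in each variable. -/
def trigSpace (N : ℕ) : Submodule ℝ (ℝ × ℝ → ℝ) :=
  Submodule.span ℝ {u | ∃ (a b : ℤ) (θ : ℝ), |a| ≤ N ∧ |b| ≤ N ∧ u = wave (a, b, θ)}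

theorem wave_mem_trigSpace {N : ℕ} {a b : ℤ} (θ : ℝ) (ha : |a| ≤ N) (hb : |b| ≤ N) :
    wave (a, b, θ) ∈ trigSpace N :=
  Submodule.subset_span ⟨a, b, θ, ha, hb, rfl⟩

theorem trigSpace_mono {M N : ℕ} (h : M ≤ N) : trigSpace M ≤ trigSpace N := by
  refine Submodule.span_mono ?_
  rintro _ ⟨a, b, θ, ha, hb, rfl⟩
  exact ⟨a, b, θ, ha.trans (by exact_mod_cast h), hb.trans (by exact_mod_cast h), rfl⟩

/-- Product-to-sum formula. -/
theorem mul_mem_trigSpace {M N : ℕ} {u v : ℝ × ℝ → ℝ} (hu : u ∈ trigSpace M)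
    (hv : v ∈ trigSpace N) : u * v ∈ trigSpace (M + N) := by
  have h := Submodule.mul_mem_mul hu hv
  rw [trigSpace, trigSpace, Submodule.span_mul_span] at h
  refine Submodule.span_le.mpr ?_ h
  rintro _ ⟨_, ⟨a, b, θ, ha, hb, rfl⟩, _, ⟨a', b', θ', ha', hb', rfl⟩, rfl⟩
  have e : wave (a, b, θ) * wave (a', b', θ') =
      (1 / 2 : ℝ) • wave (a + a', b + b', θ + θ') + (1 / 2 : ℝ) • wave (a - a', b - b', θ - θ') := by
    ext p
    simp only [wave, Pi.mul_apply, Pi.add_apply, Pi.smul_apply, smul_eq_mul, Int.cast_add,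
      Int.cast_sub]
    set x := 2 * Real.pi * (a * p.1 + b * p.2) + θ
    set y := 2 * Real.pi * (a' * p.1 + b' * p.2) + θ'
    rw [show 2 * Real.pi * ((a + a') * p.1 + (b + b') * p.2) + (θ + θ') = x + y by ring,
      show 2 * Real.pi * ((a - a') * p.1 + (b - b') * p.2) + (θ - θ') = x - y by ring,
      Real.cos_add x y, Real.cos_sub x y]
    ring
  change wave (a, b, θ) * wave (a', b', θ') ∈ trigSpace (M + N)
  rw [e]
  refine Submodule.add_mem _ (Submodule.smul_mem _ _ (wave_mem_trigSpace _ ?_ ?_))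
    (Submodule.smul_mem _ _ (wave_mem_trigSpace _ ?_ ?_)) <;> push_cast
  · exact (abs_add_le _ _).trans (add_le_add ha ha')
  · exact (abs_add_le _ _).trans (add_le_add hb hb')
  · exact (abs_sub _ _).trans (add_le_add ha ha')
  · exact (abs_sub _ _).trans (add_le_add hb hb')

theorem contDiff_of_mem_trigSpace {N : ℕ} {u : ℝ × ℝ → ℝ} (hu : u ∈ trigSpace N) {n : WithTop ℕ∞} :
    ContDiff ℝ n u := by
  induction hu using Submodule.span_induction with
  | mem u hu => obtain ⟨a, b, θ, -, -, rfl⟩ := hu; exact contDiff_wave _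
  | zero => exact contDiff_const
  | add u v _ _ hu hv => exact hu.add hv
  | smul c u _ hu => exact contDiff_const.smul hu

/-- Indices of the real and imaginary parts of the exponentials of degree at most `N`. -/
abbrev WaveIndex (N : ℕ) : Type :=
  Finset.Icc (-N : ℤ) N × Finset.Icc (-N : ℤ) N × Bool

/-- The plane wave with a given index. -/
def waveOf (N : ℕ) (i : WaveIndex N) : ℤ × ℤ × ℝ :=
  (i.1, i.2.1, if i.2.2 then 0 else -(Real.pi / 2))

/-- By the addition formula the phases `0` and `-π/2` (cosine and sine) suffice, so finitely many
parameters reach every trigonometric Hamiltonian of bounded degree. -/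
theorem exists_eq_sum_of_mem_trigSpace {N : ℕ} {u : ℝ × ℝ → ℝ} (hu : u ∈ trigSpace N) :
    ∃ v : WaveIndex N → ℝ, u = ∑ i, v i • wave (waveOf N i) := by
  have h : trigSpace N ≤ Submodule.span ℝ (range fun i => wave (waveOf N i)) := by
    refine Submodule.span_le.mpr ?_
    rintro _ ⟨a, b, θ, ha, hb, rfl⟩
    have ha' : a ∈ Finset.Icc (-N : ℤ) N := Finset.mem_Icc.mpr (abs_le.mp ha)
    have hb' : b ∈ Finset.Icc (-N : ℤ) N := Finset.mem_Icc.mpr (abs_le.mp hb)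
    have e : wave (a, b, θ) = Real.cos θ • wave (waveOf N (⟨a, ha'⟩, ⟨b, hb'⟩, true)) +
        (-Real.sin θ) • wave (waveOf N (⟨a, ha'⟩, ⟨b, hb'⟩, false)) := by
      ext p
      simp only [wave, waveOf, Pi.add_apply, Pi.smul_apply, smul_eq_mul, if_true, add_zero,
        Bool.false_eq_true, if_false, ← sub_eq_add_neg, Real.cos_sub_pi_div_two, Real.cos_add]
      ring
    rw [e]
    exact Submodule.add_mem _ (Submodule.smul_mem _ _ (Submodule.subset_span ⟨_, rfl⟩))
      (Submodule.smul_mem _ _ (Submodule.subset_span ⟨_, rfl⟩))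
  obtain ⟨v, hv⟩ := (Submodule.mem_span_range_iff_exists_fun ℝ).mp (h hu)
  exact ⟨v, hv.symm⟩

/-! ### Products and jets -/

section Jets

variable {u v : ℝ × ℝ → ℝ} {p : ℝ × ℝ}

theorem fderiv_mul_of_eq_zero (hu : ContDiff ℝ 2 u) (hv : ContDiff ℝ 2 v) (h : v p = 0) :
    fderiv ℝ (u * v) p = u p • fderiv ℝ v p := by
  rw [fderiv_mul (hu.differentiable (by norm_num) p) (hv.differentiable (by norm_num) p), h,
    zero_smul, add_zero]

theorem fderiv_fderiv_mul_of_eq_zero (hu : ContDiff ℝ 2 u) (hv : ContDiff ℝ 2 v) (h : v p = 0)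
    (h' : fderiv ℝ v p = 0) :
    fderiv ℝ (fderiv ℝ (u * v)) p = u p • fderiv ℝ (fderiv ℝ v) p := by
  have hud := hu.differentiable (by norm_num)
  have hvd := hv.differentiable (by norm_num)
  have e : fderiv ℝ (u * v) = fun q => u q • fderiv ℝ v q + v q • fderiv ℝ u q := by
    ext1 q
    exact fderiv_mul (hud q) (hvd q)
  have hu2 := (((hu.fderiv_right (m := 1) (by norm_num)).differentiable (by norm_num)) p).hasFDerivAt
  have hv2 := (((hv.fderiv_right (m := 1) (by norm_num)).differentiable (by norm_num)) p).hasFDerivAt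
  have h4 : HasFDerivAt (fun q => u q • fderiv ℝ v q + v q • fderiv ℝ u q) _ p :=
    ((hud p).hasFDerivAt.smul hv2).add ((hvd p).hasFDerivAt.smul hu2)
  rw [e, h4.fderiv, h, h']
  ext
  all_goals simp

theorem fderiv_sum_smul {ι : Type*} [Fintype ι] {H : ι → ℝ × ℝ → ℝ} (hH : ∀ i, ContDiff ℝ 2 (H i))
    (c : ι → ℝ) : fderiv ℝ (∑ i, c i • H i) = fun p => ∑ i, c i • fderiv ℝ (H i) p := by
  ext1 p
  rw [fderiv_sum fun i _ => ((hH i).differentiable (by norm_num) p).const_smul _]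
  refine Finset.sum_congr rfl fun i _ => ?_
  exact fderiv_const_smul ((hH i).differentiable (by norm_num) p) _

theorem sum_jetField {ι : Type*} [Fintype ι] {H : ι → ℝ × ℝ → ℝ} (hH : ∀ i, ContDiff ℝ 2 (H i))
    (c : ι → ℝ) (z : (ℝ × ℝ) × (ℝ × ℝ →L[ℝ] ℝ × ℝ)) :
    ∑ i, c i • jetField (H i) z = jetField (∑ i, c i • H i) z := by
  have h2 : fderiv ℝ (fderiv ℝ (∑ i, c i • H i)) z.1 =
      ∑ i, c i • fderiv ℝ (fderiv ℝ (H i)) z.1 := by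
    rw [fderiv_sum_smul hH]
    have hd : ∀ i, DifferentiableAt ℝ (fderiv ℝ (H i)) z.1 := fun i =>
      ((hH i).fderiv_right (m := 1) (by norm_num)).differentiable (by norm_num) _
    have hd' : ∀ i, DifferentiableAt ℝ (fun p => c i • fderiv ℝ (H i) p) z.1 := fun i =>
      (hd i).fun_const_smul _
    rw [fderiv_fun_sum fun i _ => hd' i]
    refine Finset.sum_congr rfl fun i _ => ?_
    exact fderiv_const_smul (hd i) (c i)
  have h1 := congrFun (fderiv_sum_smul hH c) z.1
  simp only [jetField, hamField, hamFieldDeriv, h2, h1]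
  refine Prod.ext ?_ ?_
  · simp [Prod.fst_sum]
  · ext <;> simp [Prod.snd_sum, Prod.fst_sum]

end Jets

/-- A nonnegative trigonometric polynomial of degree one vanishing precisely at the translates of
`p`. -/
def bump (p : ℝ × ℝ) : ℝ × ℝ → ℝ :=
  (2 : ℝ) • wave (0, 0, 0) - wave (1, 0, -(2 * Real.pi * p.1)) - wave (0, 1, -(2 * Real.pi * p.2))

theorem bump_mem_trigSpace (p : ℝ × ℝ) : bump p ∈ trigSpace 1 :=
  Submodule.sub_mem _ (Submodule.sub_mem _ (Submodule.smul_mem _ _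
    (wave_mem_trigSpace _ (by simp) (by simp))) (wave_mem_trigSpace _ (by simp) (by simp)))
    (wave_mem_trigSpace _ (by simp) (by simp))

theorem bump_apply (p q : ℝ × ℝ) : bump p q =
    (1 - Real.cos (2 * Real.pi * (q.1 - p.1))) + (1 - Real.cos (2 * Real.pi * (q.2 - p.2))) := by
  simp only [bump, wave, Pi.sub_apply, Pi.smul_apply, smul_eq_mul]
  simp only [Int.cast_zero, Int.cast_one, zero_mul, one_mul, add_zero, mul_zero, zero_add,
    Real.cos_zero, ← sub_eq_add_neg, ← mul_sub]
  ring

theorem bump_self (p : ℝ × ℝ) : bump p p = 0 := by simp [bump_apply]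

theorem fderiv_bump_self (p : ℝ × ℝ) : fderiv ℝ (bump p) p = 0 := by
  have hmin : IsLocalMin (bump p) p := by
    refine Eventually.of_forall fun q => ?_
    rw [bump_self, bump_apply]
    linarith [Real.cos_le_one (2 * Real.pi * (q.1 - p.1)),
      Real.cos_le_one (2 * Real.pi * (q.2 - p.2))]
  exact hmin.fderiv_eq_zero

theorem bump_ne_zero {p q : ℝ × ℝ} (h : realProj p ≠ realProj q) : bump p q ≠ 0 := by
  intro h0
  rw [bump_apply] at h0
  have h1 := Real.cos_le_one (2 * Real.pi * (q.1 - p.1))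
  have h2 := Real.cos_le_one (2 * Real.pi * (q.2 - p.2))
  obtain ⟨m, hm⟩ := (Real.cos_eq_one_iff (2 * Real.pi * (q.1 - p.1))).mp (by linarith)
  obtain ⟨k, hk⟩ := (Real.cos_eq_one_iff (2 * Real.pi * (q.2 - p.2))).mp (by linarith)
  refine h (realProj_eq_iff.mpr ⟨m, k, ?_⟩).symm
  have hpi := Real.pi_pos
  ext
  · simp only [Prod.fst_add]
    have : 2 * Real.pi * (q.1 - p.1 - m) = 0 := by linarith
    have := (mul_eq_zero.mp this).resolve_left (by positivity)
    linarith
  · simp only [Prod.snd_add]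
    have : 2 * Real.pi * (q.2 - p.2 - k) = 0 := by linarith
    have := (mul_eq_zero.mp this).resolve_left (by positivity)
    linarith

/-- A trigonometric polynomial which is flat at the points of `P` and has a prescribed leading jet at
`p₀`. -/
theorem exists_trigSpace_flat (P : Finset (ℝ × ℝ)) {p₀ : ℝ × ℝ}
    (hP : ∀ p ∈ P, realProj p ≠ realProj p₀) {u : ℝ × ℝ → ℝ} (hu : u ∈ trigSpace 1)
    (hu0 : u p₀ = 0) : ∃ H ∈ trigSpace (2 * P.card + 1),
      (∀ p ∈ P, fderiv ℝ H p = 0 ∧ fderiv ℝ (fderiv ℝ H) p = 0) ∧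
      fderiv ℝ H p₀ = fderiv ℝ u p₀ ∧
      (fderiv ℝ u p₀ = 0 → fderiv ℝ (fderiv ℝ H) p₀ = fderiv ℝ (fderiv ℝ u) p₀) := by
  -- The witness is `c • K * u`, where `K` is the product of the squared bumps, nonzero at `p₀`, and
  -- `c` normalises `K p₀` to `1`. Each square costs degree `2`.
  have hK : ∀ Q : Finset (ℝ × ℝ), (∏ p ∈ Q, bump p * bump p) ∈ trigSpace (2 * Q.card) := by
    intro Q
    induction Q using Finset.induction_on with
    | empty =>
      have e : (1 : ℝ × ℝ → ℝ) = wave (0, 0, 0) := by ext; simp [wave]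
      rw [Finset.prod_empty, e]
      exact wave_mem_trigSpace _ (by simp) (by simp)
    | insert p Q hp ih =>
      rw [Finset.prod_insert hp, Finset.card_insert_of_notMem hp,
        show 2 * (Q.card + 1) = (1 + 1) + 2 * Q.card by ring]
      exact mul_mem_trigSpace (mul_mem_trigSpace (bump_mem_trigSpace p) (bump_mem_trigSpace p)) ih
  set K := ∏ p ∈ P, bump p * bump p with hKdef
  set c := (K p₀)⁻¹ with hc
  have hK0 : K p₀ ≠ 0 := by
    rw [hKdef, Finset.prod_apply, Finset.prod_ne_zero_iff]
    intro p hp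
    exact mul_ne_zero (bump_ne_zero (hP p hp)) (bump_ne_zero (hP p hp))
  have hcK : c • K ∈ trigSpace (2 * P.card) := Submodule.smul_mem _ _ (hK P)
  have hc1 : (c • K) p₀ = 1 := by simp [hc, hK0]
  have hmem := mul_mem_trigSpace hcK hu
  have hcd := contDiff_of_mem_trigSpace hcK (n := 2)
  have hud := contDiff_of_mem_trigSpace hu (n := 2)
  refine ⟨(c • K) * u, hmem, fun p hp => ?_, ?_, fun h => ?_⟩
  · have e : (c • K) * u = (bump p * (c • ((∏ q ∈ P.erase p, bump q * bump q) * u))) * bump p := by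
      rw [hKdef, ← Finset.mul_prod_erase P _ hp]
      ext q
      simp only [Pi.mul_apply, Pi.smul_apply, smul_eq_mul]
      ring
    have hb := contDiff_of_mem_trigSpace (bump_mem_trigSpace p) (n := 2)
    have hR : ContDiff ℝ 2 (bump p * (c • ((∏ q ∈ P.erase p, bump q * bump q) * u))) :=
      contDiff_of_mem_trigSpace (mul_mem_trigSpace (bump_mem_trigSpace p)
        (Submodule.smul_mem _ c (mul_mem_trigSpace (hK _) hu)))
    have hR0 : (bump p * (c • ((∏ q ∈ P.erase p, bump q * bump q) * u))) p = 0 := by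
      rw [Pi.mul_apply, bump_self, zero_mul]
    rw [e, fderiv_mul_of_eq_zero hR hb (bump_self p),
      fderiv_fderiv_mul_of_eq_zero hR hb (bump_self p) (fderiv_bump_self p), hR0]
    constructor <;> ext <;> simp
  · rw [fderiv_mul_of_eq_zero hcd hud hu0, hc1, one_smul]
  · rw [fderiv_fderiv_mul_of_eq_zero hcd hud hu0 h, hc1, one_smul]

/-! ### Localised kicks with prescribed jet -/

/-- The derivative of the Hamiltonian vector field of `(ax + by)² / 2`. -/
def shearMatrix (a b : ℤ) : ℝ × ℝ →L[ℝ] ℝ × ℝ :=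
  ((a : ℝ) • ContinuousLinearMap.fst ℝ ℝ ℝ + (b : ℝ) • ContinuousLinearMap.snd ℝ ℝ ℝ).smulRight
    ((b : ℝ), -(a : ℝ))

theorem shearMatrix_apply (a b : ℤ) (v : ℝ × ℝ) :
    shearMatrix a b v = (a * v.1 + b * v.2) • ((b : ℝ), -(a : ℝ)) := rfl

theorem hamFieldDeriv_wave (w : ℤ × ℤ × ℝ) (p : ℝ × ℝ) : hamFieldDeriv (wave w) p =
    (-((2 * Real.pi) ^ 2 * wave w p)) • shearMatrix w.1 w.2.1 := by
  refine (hasFDerivAt_hamField (contDiff_wave w) p).unique ?_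
  have e : hamField (wave w) = fun p =>
      (-(2 * Real.pi * Real.sin (2 * Real.pi * (w.1 * p.1 + w.2.1 * p.2) + w.2.2))) •
      ((w.2.1 : ℝ), -(w.1 : ℝ)) := funext (hamField_wave w)
  rw [e]
  have h : HasFDerivAt (fun p : ℝ × ℝ => 2 * Real.pi * (w.1 * p.1 + w.2.1 * p.2) + w.2.2)
      ((2 * Real.pi) • ((w.1 : ℝ) • ContinuousLinearMap.fst ℝ ℝ ℝ +
        (w.2.1 : ℝ) • ContinuousLinearMap.snd ℝ ℝ ℝ)) p :=
    (((hasFDerivAt_fst.const_mul _).add (hasFDerivAt_snd.const_mul _)).const_mul _).add_const _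
  refine ((h.sin.const_mul (2 * Real.pi)).neg.smul_const _).congr_fderiv ?_
  ext <;> simp [shearMatrix_apply, wave] <;> ring

/-- Trigonometric Hamiltonians, flat at given points, whose vector field has a prescribed value at
`p₀`. -/
theorem exists_kick_value (P : Finset (ℝ × ℝ)) {p₀ : ℝ × ℝ}
    (hP : ∀ p ∈ P, realProj p ≠ realProj p₀) (e : ℝ × ℝ) : ∃ H ∈ trigSpace (2 * P.card + 1),
      (∀ p ∈ P, hamField H p = 0 ∧ hamFieldDeriv H p = 0) ∧ hamField H p₀ = e := by
  -- The phase `π / 2` turns cosines into minus sines, so near `p₀` this is `e.1 * (y - p₀.2) - e.2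
  -- * (x - p₀.1)` to first order.
  set u : ℝ × ℝ → ℝ := (e.2 / (2 * Real.pi)) • wave (1, 0, -(2 * Real.pi * p₀.1) + Real.pi / 2) -
    (e.1 / (2 * Real.pi)) • wave (0, 1, -(2 * Real.pi * p₀.2) + Real.pi / 2) with hu
  have hmem : u ∈ trigSpace 1 := Submodule.sub_mem _
    (Submodule.smul_mem _ _ (wave_mem_trigSpace _ (by simp) (by simp)))
    (Submodule.smul_mem _ _ (wave_mem_trigSpace _ (by simp) (by simp)))
  have hu0 : u p₀ = 0 := by
    simp [hu, wave]
  have hud : fderiv ℝ u p₀ = (-e.2) • ContinuousLinearMap.fst ℝ ℝ ℝ +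
      e.1 • ContinuousLinearMap.snd ℝ ℝ ℝ := by
    rw [hu, (((hasFDerivAt_wave _ p₀).const_smul _).sub
      ((hasFDerivAt_wave _ p₀).const_smul _)).fderiv]
    have hpi := Real.pi_ne_zero
    ext <;> simp
  obtain ⟨H, hH, h1, h2, -⟩ := exists_trigSpace_flat P hP hmem hu0
  refine ⟨H, hH, fun p hp => ?_, ?_⟩
  · simp [hamField, hamFieldDeriv, h1 p hp]
  · rw [hamField, h2, hud, symplGrad_apply]
    simp

/-- Trigonometric Hamiltonians, flat at given points, whose vector field vanishes at `p₀` and has a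
prescribed derivative there. -/
theorem exists_kick_deriv (P : Finset (ℝ × ℝ)) {p₀ : ℝ × ℝ}
    (hP : ∀ p ∈ P, realProj p ≠ realProj p₀) {a b : ℤ} (ha : |a| ≤ 1) (hb : |b| ≤ 1) :
    ∃ H ∈ trigSpace (2 * P.card + 1),
      (∀ p ∈ P, hamField H p = 0 ∧ hamFieldDeriv H p = 0) ∧ hamField H p₀ = 0 ∧
      hamFieldDeriv H p₀ = shearMatrix a b := by
  set w : ℤ × ℤ × ℝ := (a, b, -(2 * Real.pi * (a * p₀.1 + b * p₀.2))) with hw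
  set c : ℝ := ((2 * Real.pi) ^ 2)⁻¹ with hc
  -- Since `1 - cos s ≈ s² / 2`, this is `(a(x - p₀.1) + b(y - p₀.2))² / 2` to second order.
  set u : ℝ × ℝ → ℝ := c • (wave (0, 0, 0) - wave w) with hu
  have hmem : u ∈ trigSpace 1 := Submodule.smul_mem _ _ (Submodule.sub_mem _
    (wave_mem_trigSpace _ (by simp) (by simp))
    (wave_mem_trigSpace _ (by exact_mod_cast ha) (by exact_mod_cast hb)))
  have hw0 : wave w p₀ = 1 := by simp [hw, wave]
  have hw1 : wave (0, 0, 0) = fun _ => 1 := by ext; simp [wave]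
  have hu0 : u p₀ = 0 := by simp [hu, hw0, hw1]
  have hd : fderiv ℝ u = (-c) • fderiv ℝ (wave w) := by
    ext1 p
    rw [hu, hw1, fderiv_const_smul ((differentiable_const _).sub
      ((contDiff_wave w (n := 1)).differentiable (by norm_num)) p)]
    have : fderiv ℝ ((fun _ => (1 : ℝ)) - wave w) p = -fderiv ℝ (wave w) p :=
      fderiv_const_sub _
    rw [this]
    ext <;> simp
  have hd0 : fderiv ℝ u p₀ = 0 := by
    rw [hd, Pi.smul_apply, (hasFDerivAt_wave w p₀).fderiv]
    simp [hw]
  obtain ⟨H, hH, h1, h2, h3⟩ := exists_trigSpace_flat P hP hmem hu0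
  refine ⟨H, hH, fun p hp => ?_, ?_, ?_⟩
  · simp [hamField, hamFieldDeriv, h1 p hp]
  · simp [hamField, h2, hd0]
  · have h4 := hamFieldDeriv_wave w p₀
    rw [hw0] at h4
    have h5 : fderiv ℝ (fderiv ℝ u) p₀ = (-c) • fderiv ℝ (fderiv ℝ (wave w)) p₀ := by
      rw [hd]
      exact fderiv_const_smul ((((contDiff_wave w (n := 2)).fderiv_right (m := 1)
        (by norm_num)).differentiable (by norm_num)) p₀) _
    have h6 : hamFieldDeriv H p₀ = (-c) • hamFieldDeriv (wave w) p₀ := by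
      rw [hamFieldDeriv, hamFieldDeriv, h3 hd0, h5, ContinuousLinearMap.comp_smul]
    rw [h6, h4, smul_smul, mul_one, neg_mul_neg, hc, inv_mul_cancel₀ (by positivity), one_smul]

end

noncomputable section

/-! ### Parametric transversality by Hausdorff dimension -/

/-- Near a point, the fibre of a strictly differentiable map has dimension at most that of the kernel
of the derivative. -/
theorem HasStrictFDerivAt.exists_nhds_dimH_le {E F : Type*} [NormedAddCommGroup E]
    [NormedSpace ℝ E] [FiniteDimensional ℝ E] [NormedAddCommGroup F] [NormedSpace ℝ F]
    [FiniteDimensional ℝ F] {Ψ : E → F} {Ψ' : E →L[ℝ] F} {z₀ : E}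
    (h : HasStrictFDerivAt Ψ Ψ' z₀) :
    ∃ O ∈ 𝓝 z₀, dimH {z ∈ O | Ψ z = Ψ z₀} ≤ Module.finrank ℝ (LinearMap.ker (Ψ' : E →ₗ[ℝ] F)) := by
  obtain ⟨π, hπ⟩ := Ψ'.ker_closedComplemented_of_finiteDimensional_range
  -- `π` is the identity on the kernel of `Ψ'`, so `(Ψ', π)` is injective.
  obtain ⟨K, hK, hA⟩ := (Ψ'.prod π).toLinearMap.exists_antilipschitzWith (by
    rw [LinearMap.ker_eq_bot']
    intro u hu
    have h1 : Ψ' u = 0 := congrArg Prod.fst hu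
    have h2 : π u = 0 := congrArg Prod.snd hu
    have := hπ ⟨u, h1⟩
    rw [h2] at this
    exact (congrArg Subtype.val this).symm)
  have hbound : ∀ u, ‖u‖ ≤ K * max ‖Ψ' u‖ ‖π u‖ := fun u => by
    have := hA.le_mul_dist u 0
    simpa [dist_eq_norm, Prod.norm_def] using this
  -- On the fibre this gives `‖Ψ' (z - w)‖ ≤ ‖z - w‖ / (2K)`, too small to account for `‖z - w‖`
  -- unless `z = w`. Hence `π` is antilipschitz on the fibre.
  have hlo := h.isLittleO.def (c := (2 * K)⁻¹) (by positivity)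
  rw [nhds_prod_eq] at hlo
  obtain ⟨O, hO, hOO⟩ := Filter.mem_prod_same_iff.mp hlo
  refine ⟨{z | z ∈ O}, by exact hO, ?_⟩
  set s : Set E := {z | z ∈ O ∧ Ψ z = Ψ z₀} with hs
  have hanti : AntilipschitzWith K fun z : s => π z := by
    refine AntilipschitzWith.of_le_mul_dist fun z w => ?_
    have h1 := hOO (mk_mem_prod z.2.1 w.2.1)
    simp only [mem_ofPred_eq, z.2.2, w.2.2, sub_self, zero_sub, norm_neg] at h1
    have h2 := hbound (z - w)
    rw [Subtype.dist_eq, dist_eq_norm, dist_eq_norm, ← map_sub]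
    rcases le_total ‖Ψ' (z - w : E)‖ ‖π (z - w : E)‖ with h3 | h3
    · rwa [max_eq_right h3] at h2
    · rw [max_eq_left h3] at h2
      have hK' : (0 : ℝ) < K := hK
      have h4 : ‖(z - w : E)‖ ≤ ‖(z - w : E)‖ / 2 := by
        calc _ ≤ K * ‖Ψ' (z - w : E)‖ := h2
          _ ≤ K * ((2 * (K : ℝ))⁻¹ * ‖(z - w : E)‖) := by gcongr
          _ = _ := by field_simp
      have h5 : ‖(z - w : E)‖ = 0 := by linarith [norm_nonneg (z - w : E)]
      rw [h5]
      positivity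
  calc dimH s = dimH (Subtype.val '' (univ : Set s)) := by simp
    _ = dimH (univ : Set s) := isometry_subtype_coe.dimH_image _
    _ ≤ dimH ((fun z : s => π z) '' univ) := hanti.le_dimH_image _
    _ ≤ dimH (univ : Set (LinearMap.ker (Ψ' : E →ₗ[ℝ] F))) := dimH_mono (subset_univ _)
    _ = _ := Real.dimH_univ_eq_finrank _

variable {U : Set ComplexTorus}

/-- A closed condition on the derivatives at the points of period `d + 1` can be avoided by
arbitrarily small perturbations if, at each point where it holds, the period is minimal and the
condition implies the equation `l M = l M₀` for a functional `l` which is not stationary under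
infinitesimal shears. -/
theorem exists_forall_torusJacIter_notMem (hUT : ∀ x, torusIncl x ∈ U) (F : HamU U)
    (d : ℕ) {B : Set (ℝ × ℝ →L[ℝ] ℝ × ℝ)} (hBc : IsClosed B)
    (hB : ∀ x, (realMap hUT F.1)^[d + 1] x = x → torusJacIter hUT F.1 (d + 1) x ∈ B →
      (∀ j, j < d → (realMap hUT F.1)^[j + 1] x ≠ x) ∧
      ∃ l : (ℝ × ℝ →L[ℝ] ℝ × ℝ) →L[ℝ] ℝ,
        (∀ᶠ M in 𝓝 (torusJacIter hUT F.1 (d + 1) x), M ∈ B →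
          (∀ a b, planeArea (M a) (M b) = planeArea a b) →
            l M = l (torusJacIter hUT F.1 (d + 1) x)) ∧
        ∃ a b : ℤ, |a| ≤ 1 ∧ |b| ≤ 1 ∧
          l ((shearMatrix a b).comp (torusJacIter hUT F.1 (d + 1) x)) ≠ 0)
    {V : Set (HamU U)} (hV : V ∈ 𝓝 F) :
    ∃ G ∈ V, ∀ x, (realMap hUT G.1)^[d + 1] x = x → torusJacIter hUT G.1 (d + 1) x ∉ B := by
  obtain ⟨L, hL⟩ := exists_isSmoothLift hUT F.2
  -- Degree `2d` flattens a Hamiltonian at `d` orbit points, and one more degree prescribes its jet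
  -- at the return point.
  set W := waveOf (2 * d + 1)
  set l : List (WaveIndex (2 * d + 1)) := Finset.univ.toList with hl
  set G : (WaveIndex (2 * d + 1) → ℝ) → HamU U := fun ε =>
    ⟨perturb W F.1 l ε, (perturb_spec hUT W F.2 hL l ε).1⟩ with hG
  have hGc : Continuous G := (continuous_perturb W F.1 l).subtype_mk _
  have hG0 : G 0 = F := Subtype.ext (perturb_zero W F.1 l)
  have hGL : ∀ ε, IsSmoothLift (realMap hUT (G ε).1)
      (fun p => kick (fun i => hamField (wave (W i))) l ε (L p)) := fun ε =>
    (perturb_spec hUT W F.2 hL l ε).2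
  have hY : ∀ i, ContDiff ℝ 1 (jetField (wave (W i))) := fun i => contDiff_jetField (contDiff_wave _)
  have hT : ContDiff ℝ 1 (jetMap L) := contDiff_jetMap (hL.contDiff.of_le (by simp))
  set Θ : (WaveIndex (2 * d + 1) → ℝ) × (ℝ × ℝ) → (ℝ × ℝ) × (ℝ × ℝ →L[ℝ] ℝ × ℝ) := fun q =>
    (fun z => kick (fun i => jetField (wave (W i))) l q.1 (jetMap L z))^[d + 1]
      (q.2, ContinuousLinearMap.id ℝ _) with hΘ
  have hincl : ContDiff ℝ 1 (fun q : (WaveIndex (2 * d + 1) → ℝ) × (ℝ × ℝ) =>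
      ((q.1, (q.2, ContinuousLinearMap.id ℝ (ℝ × ℝ))) :
        (WaveIndex (2 * d + 1) → ℝ) × ((ℝ × ℝ) × (ℝ × ℝ →L[ℝ] ℝ × ℝ)))) :=
    contDiff_fst.prodMk (contDiff_snd.prodMk contDiff_const)
  have hΘc : ContDiff ℝ 1 Θ := (contDiff_iterate_kick hY l hT (d + 1)).comp hincl
  have hjet : ∀ ε p, IsJetAt (fun q => kick (fun i => hamField (wave (W i))) l ε (L q))^[d + 1] p
      (Θ (ε, p)) := fun ε p =>
    IsJetAt.iterate_kick (fun i => contDiff_wave (W i)) l ε hL.differentiable (d + 1) p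
  have hΘ1 : ∀ ε p, realProj (Θ (ε, p)).1 = (realMap hUT (G ε).1)^[d + 1] (realProj p) := by
    intro ε p
    rw [(hjet ε p).1, ((hGL ε).iterate (d + 1)).realProj_apply]
  have hΘ2 : ∀ ε p, (Θ (ε, p)).2 = torusJacIter hUT (G ε).1 (d + 1) (realProj p) := fun ε p =>
    (hjet ε p).2.unique (hasFDerivAt_iterate_lift hUT (G ε).2 (hGL ε) (d + 1) p)
  set Bad : Set ((WaveIndex (2 * d + 1) → ℝ) × (ℝ × ℝ)) :=
    {q | realProj (Θ q).1 = realProj q.2 ∧ (Θ q).2 ∈ B} with hBad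
  have hBadc : IsClosed Bad :=
    (isClosed_eq (continuous_realProj.comp (continuous_fst.comp hΘc.continuous))
      (continuous_realProj.comp continuous_snd)).inter
      (hBc.preimage (continuous_snd.comp hΘc.continuous))
  set m := Module.finrank ℝ (WaveIndex (2 * d + 1) → ℝ) with hm
  have hmpos : 0 < m := by
    have : Nonempty (WaveIndex (2 * d + 1)) :=
      ⟨⟨0, Finset.mem_Icc.mpr ⟨by omega, by omega⟩⟩, ⟨0, Finset.mem_Icc.mpr ⟨by omega, by omega⟩⟩,
        true⟩
    rw [hm, Module.finrank_fintype_fun_eq_card]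
    exact Fintype.card_pos
  have hlocal : ∀ p₀, ∃ O ∈ 𝓝 ((0 : WaveIndex (2 * d + 1) → ℝ), p₀),
      dimH (Prod.fst '' {q ∈ O | q ∈ Bad}) ≤ (m - 1 : ℕ) := by
    intro p₀
    by_cases hp₀ : ((0 : WaveIndex (2 * d + 1) → ℝ), p₀) ∈ Bad
    swap
    · refine ⟨Badᶜ, hBadc.isOpen_compl.mem_nhds hp₀, ?_⟩
      have : {q ∈ Badᶜ | q ∈ Bad} = ∅ := by ext q; simp
      rw [this, image_empty, dimH_empty]
      exact bot_le
    set x₀ := realProj p₀ with hx₀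
    have hx1 : (realMap hUT F.1)^[d + 1] x₀ = x₀ := by
      have := hp₀.1
      rwa [hΘ1, hG0] at this
    set M₀ := torusJacIter hUT F.1 (d + 1) x₀ with hM₀
    have hΘM : (Θ (0, p₀)).2 = M₀ := by rw [hΘ2, hG0]
    have hx2 : M₀ ∈ B := by rw [← hΘM]; exact hp₀.2
    obtain ⟨hmin, lam, hlam, a, b, ha, hb, hab⟩ := hB x₀ hx1 hx2
    have hT1 : ∀ j, ((jetMap L)^[j] (p₀, ContinuousLinearMap.id ℝ _)).1 = L^[j] p₀ := by
      intro j
      induction j with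
      | zero => rfl
      | succ j ih => rw [Function.iterate_succ_apply', Function.iterate_succ_apply', ← ih]; rfl
    have hT2 : (jetMap L)^[d + 1] (p₀, ContinuousLinearMap.id ℝ _) = Θ (0, p₀) := by
      simp only [hΘ, kick_zero]
    -- The intermediate orbit points. Minimality of the period separates them on the torus from the
    -- return point.
    set P : Finset (ℝ × ℝ) := (Finset.range d).image fun j => L^[j + 1] p₀ with hP
    have hPcard : P.card ≤ d := Finset.card_image_le.trans (by simp)
    have hPne : ∀ p ∈ P, realProj p ≠ realProj (L^[d + 1] p₀) := by
      intro p hp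
      obtain ⟨j, hj, rfl⟩ := Finset.mem_image.mp hp
      rw [(hL.iterate _).realProj_apply, (hL.iterate _).realProj_apply, hx1]
      exact hmin j (Finset.mem_range.mp hj)
    have hvar : ∀ H ∈ trigSpace (2 * P.card + 1),
        (∀ p ∈ P, hamField H p = 0 ∧ hamFieldDeriv H p = 0) →
        ∃ v : WaveIndex (2 * d + 1) → ℝ, fderiv ℝ Θ (0, p₀) (v, 0) =
          (hamField H (L^[d + 1] p₀), (hamFieldDeriv H (L^[d + 1] p₀)).comp M₀) := by
      intro H hH hHP
      obtain ⟨v, hv⟩ := exists_eq_sum_of_mem_trigSpace (trigSpace_mono (by omega) hH :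
        H ∈ trigSpace (2 * d + 1))
      have hsum : ∀ z, (l.map fun i => v i • jetField (wave (W i)) z).sum = jetField H z := by
        intro z
        rw [hl, Finset.sum_map_toList, sum_jetField (fun i => contDiff_wave _), hv]
      refine ⟨v, ?_⟩
      have h1 := fderiv_iterate_kick hY l hT d (p₀, ContinuousLinearMap.id ℝ (ℝ × ℝ)) (v := v)
        (fun j hj => by
          rw [hsum]
          have hmem : L^[j + 1] p₀ ∈ P := Finset.mem_image.mpr ⟨j, Finset.mem_range.mpr hj, rfl⟩
          simp only [jetField, hT1, (hHP _ hmem).1, (hHP _ hmem).2, ContinuousLinearMap.zero_comp]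
          rfl)
      rw [hsum, hT2, jetField] at h1
      rw [hΘM, ← hT2, hT1] at h1
      rw [← h1]
      have h2 : HasFDerivAt Θ _ (0, p₀) := HasFDerivAt.comp
        (f := fun q : (WaveIndex (2 * d + 1) → ℝ) × (ℝ × ℝ) =>
          ((q.1, (q.2, ContinuousLinearMap.id ℝ (ℝ × ℝ))) :
            (WaveIndex (2 * d + 1) → ℝ) × ((ℝ × ℝ) × (ℝ × ℝ →L[ℝ] ℝ × ℝ)))) (0, p₀)
        ((contDiff_iterate_kick hY l hT (d + 1)).differentiable (by norm_num) _).hasFDerivAt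
        (hasFDerivAt_fst.prodMk (hasFDerivAt_snd.prodMk (hasFDerivAt_const _ _)))
      rw [h2.fderiv]
      rfl
    have hΘd := (hΘc.contDiffAt (x := ((0 : WaveIndex (2 * d + 1) → ℝ), p₀))).hasStrictFDerivAt
      (by norm_num)
    -- The three equations: displacement after `d + 1` steps, and the value of `lam` on the
    -- derivative.
    have hΨ := (hΘd.fst.sub hasStrictFDerivAt_snd).prodMk
      (lam.hasStrictFDerivAt.comp _ hΘd.snd)
    set Ψ' := ((ContinuousLinearMap.fst ℝ (ℝ × ℝ) (ℝ × ℝ →L[ℝ] ℝ × ℝ)).comp (fderiv ℝ Θ (0, p₀)) -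
      ContinuousLinearMap.snd ℝ (WaveIndex (2 * d + 1) → ℝ) (ℝ × ℝ)).prod
      (lam.comp ((ContinuousLinearMap.snd ℝ (ℝ × ℝ) (ℝ × ℝ →L[ℝ] ℝ × ℝ)).comp
        (fderiv ℝ Θ (0, p₀)))) with hΨ'
    have hΨ'v : ∀ v, Ψ' (v, 0) = ((fderiv ℝ Θ (0, p₀) (v, 0)).1,
        lam (fderiv ℝ Θ (0, p₀) (v, 0)).2) := by
      intro v
      simp [hΨ']
    -- A triangular system: `H₁` realises the displacement `e`, and `H₂`, which does not move the
    -- return point, corrects the value of `lam`.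
    have hsurj : Function.Surjective Ψ' := by
      rintro ⟨e, c⟩
      obtain ⟨H₁, hH₁, hf₁, he₁⟩ := exists_kick_value P hPne e
      obtain ⟨H₂, hH₂, hf₂, he₂, hd₂⟩ := exists_kick_deriv P hPne ha hb
      obtain ⟨v₁, hv₁⟩ := hvar H₁ hH₁ hf₁
      obtain ⟨v₂, hv₂⟩ := hvar H₂ hH₂ hf₂
      rw [he₁] at hv₁
      rw [he₂, hd₂] at hv₂
      set r := lam ((shearMatrix a b).comp M₀)
      set c₁ := lam ((hamFieldDeriv H₁ (L^[d + 1] p₀)).comp M₀)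
      refine ⟨(v₁, 0) + ((c - c₁) / r) • (v₂, 0), ?_⟩
      rw [map_add, map_smul, hΨ'v, hΨ'v, hv₁, hv₂]
      ext
      · simp
      · simp
      · simp only [Prod.snd_add, Prod.smul_snd, smul_eq_mul]
        change c₁ + (c - c₁) / r * r = c
        rw [div_mul_cancel₀ _ hab]
        ring
    obtain ⟨O, hO, hdim⟩ := hΨ.exists_nhds_dimH_le
    -- `m + 2` unknowns and three independent equations.
    have hker : Module.finrank ℝ (LinearMap.ker Ψ'.toLinearMap) = m - 1 := by
      have h1 := LinearMap.finrank_range_add_finrank_ker Ψ'.toLinearMap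
      rw [LinearMap.range_eq_top.mpr hsurj, finrank_top] at h1
      simp only [Module.finrank_prod, Module.finrank_self, ← hm] at h1
      omega
    have hev1 := eventually_sub_eq_of_realProj_eq (X := (WaveIndex (2 * d + 1) → ℝ) × (ℝ × ℝ))
      (u := fun q => (Θ q).1) (v := fun q => q.2) (p := (0, p₀))
      (continuous_fst.comp hΘc.continuous).continuousAt continuous_snd.continuousAt hp₀.1
    have hev2 : ∀ᶠ q in 𝓝 ((0 : WaveIndex (2 * d + 1) → ℝ), p₀), (Θ q).2 ∈ B →
        (∀ a b, planeArea ((Θ q).2 a) ((Θ q).2 b) = planeArea a b) → lam (Θ q).2 = lam M₀ := by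
      have hc : ContinuousAt (fun q => (Θ q).2) ((0 : WaveIndex (2 * d + 1) → ℝ), p₀) :=
        (continuous_snd.comp hΘc.continuous).continuousAt
      have hlam' : ∀ᶠ M in 𝓝 (Θ (0, p₀)).2, M ∈ B →
          (∀ a b, planeArea (M a) (M b) = planeArea a b) → lam M = lam M₀ := by
        rw [hΘM]; exact hlam
      exact hc.eventually hlam'
    -- Near `(0, p₀)` every bad pair lies in one fibre of the three equations: the displacement is a
    -- constant integer vector, and `lam` takes its value at `M₀`. Projection to `ε` does not raise
    -- the dimension.
    refine ⟨O ∩ {q | _}, inter_mem hO (hev1.and hev2), ?_⟩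
    calc _ ≤ _ := LipschitzWith.prod_fst.dimH_image_le _
      _ ≤ _ := dimH_mono ?_
      _ ≤ _ := hdim
      _ = _ := by rw [hker]
    rintro q ⟨⟨hqO, hq1, hq2⟩, hqB⟩
    refine ⟨hqO, Prod.ext (hq1 hqB.1) ?_⟩
    change lam (Θ q).2 = lam (Θ (0, p₀)).2
    rw [hΘM]
    refine hq2 hqB.2 fun a b => ?_
    rw [show q = (q.1, q.2) from rfl, hΘ2]
    exact planeArea_torusJacIter hUT (G q.1).2 _ _ _ _
  -- Compactness of the unit square gives one neighbourhood of `ε = 0` that serves all points.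
  obtain ⟨O, hO, hdim⟩ := (isCompact_Icc.prod isCompact_Icc :
      IsCompact (Icc (0 : ℝ) 1 ×ˢ Icc (0 : ℝ) 1)).induction_on
    (p := fun S => ∃ O ∈ 𝓝 (0 : WaveIndex (2 * d + 1) → ℝ),
      dimH {ε ∈ O | ∃ p ∈ S, (ε, p) ∈ Bad} ≤ (m - 1 : ℕ))
    ⟨univ, univ_mem, by simp⟩
    (fun S T hST ⟨O, hO, h⟩ => ⟨O, hO, by
      refine (dimH_mono ?_).trans h
      rintro ε ⟨h1, p, hp, h2⟩
      exact ⟨h1, p, hST hp, h2⟩⟩)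
    (fun S T ⟨O, hO, h⟩ ⟨O', hO', h'⟩ => ⟨O ∩ O', inter_mem hO hO', by
      refine (dimH_mono (t := {ε ∈ O | ∃ p ∈ S, (ε, p) ∈ Bad} ∪
        {ε ∈ O' | ∃ p ∈ T, (ε, p) ∈ Bad}) ?_).trans ?_
      · rintro ε ⟨⟨h1, h1'⟩, p, hp | hp, h2⟩
        · exact Or.inl ⟨h1, p, hp, h2⟩
        · exact Or.inr ⟨h1', p, hp, h2⟩
      · rw [dimH_union]
        exact max_le h h'⟩)
    (fun p₀ _ => by
      obtain ⟨O, hO, h⟩ := hlocal p₀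
      rw [nhds_prod_eq] at hO
      obtain ⟨O₁, hO₁, O₂, hO₂, hOO⟩ := Filter.mem_prod_iff.mp hO
      refine ⟨O₂, mem_nhdsWithin_of_mem_nhds hO₂, O₁, hO₁, (dimH_mono ?_).trans h⟩
      rintro ε ⟨h1, p, hp, h2⟩
      exact ⟨(ε, p), ⟨hOO ⟨h1, hp⟩, h2⟩, rfl⟩)
  have hdense := dense_compl_of_dimH_lt_finrank (hdim.trans_lt
    (by rw [← hm]; exact_mod_cast Nat.sub_lt hmpos one_pos))
  have hV' : G ⁻¹' V ∈ 𝓝 (0 : WaveIndex (2 * d + 1) → ℝ) :=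
    hGc.continuousAt.preimage_mem_nhds (by rwa [hG0])
  obtain ⟨ε, hε, hεO, hεV⟩ := hdense.inter_nhds_nonempty (inter_mem hO hV')
  refine ⟨G ε, hεV, fun x hx hxB => ?_⟩
  obtain ⟨p, hp, rfl⟩ := exists_realProj_eq x
  exact hε ⟨hεO, p, hp, by rw [hΘ1]; exact hx, by rw [hΘ2]; exact hxB⟩

end

noncomputable section

/-! ### Traces of powers of area preserving maps -/

/-- The polynomials expressing `tr (M ^ j)` through `tr M` when `det M = 1`. -/
def tracePoly : ℕ → Polynomial ℝ
  | 0 => Polynomial.C 2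
  | 1 => Polynomial.X
  | j + 2 => Polynomial.X * tracePoly (j + 1) - tracePoly j

/-- Cayley–Hamilton, `M² = (tr M) M - 1`, gives the Chebyshev-type recursion. -/
theorem planeTrace_pow {M : ℝ × ℝ →L[ℝ] ℝ × ℝ} (hM : planeArea (M (1, 0)) (M (0, 1)) = 1) :
    ∀ j, planeTrace (M ^ j) = (tracePoly j).eval (planeTrace M)
  | 0 => by simp [tracePoly, planeTrace]; norm_num
  | 1 => by simp [tracePoly]
  | j + 2 => by
    have hsq : M * M = planeTrace M • M - 1 := by
      have hv : ∀ v : ℝ × ℝ, M v = v.1 • M (1, 0) + v.2 • M (0, 1) := fun v => by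
        rw [← map_smul, ← map_smul, ← map_add]; congr 1; ext <;> simp
      simp only [planeArea] at hM
      ext
      all_goals
        simp [planeTrace, hv (M (1, 0)), hv (M (0, 1))]
        first | linear_combination -hM | ring1
    have h1 : M ^ (j + 2) = planeTrace M • M ^ (j + 1) - M ^ j := by
      rw [pow_add, pow_two, hsq, mul_sub, mul_one, mul_smul_comm, pow_succ]
    have h2 : planeTrace (M ^ (j + 2)) =
        planeTrace M * planeTrace (M ^ (j + 1)) - planeTrace (M ^ j) := by
      rw [h1]
      simp only [planeTrace, sub_apply, smul_apply, Prod.fst_sub, Prod.snd_sub,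
        Prod.smul_fst, Prod.smul_snd, smul_eq_mul]
      ring
    rw [h2, planeTrace_pow hM (j + 1), planeTrace_pow hM j, tracePoly]
    simp

/-- The values at `3` start at `2` and increase strictly, so `tracePoly (j + 1) ^ 2 - 4` is not the
zero polynomial. The index `j + 1` avoids the constant `tracePoly 0 = 2`. -/
theorem finite_setOf_tracePoly_sq_eq (j : ℕ) :
    {t : ℝ | (tracePoly (j + 1)).eval t ^ 2 = 4}.Finite := by
  have h3 : ∀ j, 2 ≤ (tracePoly j).eval 3 ∧ (tracePoly j).eval 3 < (tracePoly (j + 1)).eval 3 := by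
    intro j
    induction j with
    | zero => simp [tracePoly]; norm_num
    | succ j ih =>
      have e : (tracePoly (j + 2)).eval 3 =
          3 * (tracePoly (j + 1)).eval 3 - (tracePoly j).eval 3 := by simp [tracePoly]
      rw [e]
      constructor <;> linarith
  have hne : tracePoly (j + 1) ^ 2 - Polynomial.C 4 ≠ 0 := by
    intro h
    have := congrArg (Polynomial.eval 3) h
    simp only [Polynomial.eval_sub, Polynomial.eval_pow, Polynomial.eval_C,
      Polynomial.eval_zero] at this
    nlinarith [h3 j]
  refine (Polynomial.finite_setOfPred_isRoot hne).subset fun t ht => ?_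
  simp only [mem_ofPred_eq] at ht
  simp [Polynomial.IsRoot, ht]

/-- The linear maps having a power, of exponent at most `n / d`, with trace `± 2`. -/
def degenerateSet (n d : ℕ) : Set (ℝ × ℝ →L[ℝ] ℝ × ℝ) :=
  {M | ∃ j, d * (j + 1) ≤ n ∧ planeTrace (M ^ (j + 1)) ^ 2 = 4}

theorem isClosed_degenerateSet (n d : ℕ) : IsClosed (degenerateSet n (d + 1)) := by
  have e : degenerateSet n (d + 1) = ⋃ j ∈ Finset.range (n + 1),
      {M | (d + 1) * (j + 1) ≤ n ∧ planeTrace (M ^ (j + 1)) ^ 2 = 4} := by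
    ext M
    simp only [degenerateSet, mem_ofPred_eq, mem_iUnion, Finset.mem_range, exists_prop]
    refine ⟨fun ⟨j, h1, h2⟩ => ⟨j, by nlinarith, h1, h2⟩, fun ⟨j, _, h⟩ => ⟨j, h⟩⟩
  rw [e]
  refine isClosed_biUnion_finset fun j _ => IsClosed.inter isClosed_const ?_
  exact isClosed_eq ((continuous_planeTrace.comp (continuous_pow _)).pow 2) continuous_const

/-- Only finitely many traces are degenerate, so those other than `tr M₀` stay away from it. -/
theorem eventually_planeTrace_eq (n d : ℕ) (M₀ : ℝ × ℝ →L[ℝ] ℝ × ℝ) :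
    ∀ᶠ M in 𝓝 M₀, M ∈ degenerateSet n (d + 1) →
      (∀ a b, planeArea (M a) (M b) = planeArea a b) → planeTrace M = planeTrace M₀ := by
  set T : Set ℝ := ⋃ j ∈ Finset.range (n + 1), {t : ℝ | (tracePoly (j + 1)).eval t ^ 2 = 4}
  have hT : T.Finite := (Finset.finite_toSet _).biUnion fun j _ => finite_setOf_tracePoly_sq_eq j
  have h1 : (T \ {planeTrace M₀})ᶜ ∈ 𝓝 (planeTrace M₀) :=
    (hT.subset sdiff_subset).isClosed.isOpen_compl.mem_nhds (by simp)
  filter_upwards [continuous_planeTrace.continuousAt.preimage_mem_nhds h1] with M hM hB hA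
  by_contra hne
  refine hM ⟨?_, hne⟩
  obtain ⟨j, hj, h4⟩ := hB
  rw [planeTrace_pow (by rw [hA]; simp [planeArea])] at h4
  simp only [T, mem_iUnion, exists_prop]
  exact ⟨j, Finset.mem_range.mpr (by nlinarith), h4⟩

/-- The trace as a continuous linear functional. -/
def planeTraceL : (ℝ × ℝ →L[ℝ] ℝ × ℝ) →L[ℝ] ℝ :=
  (ContinuousLinearMap.fst ℝ ℝ ℝ).comp (ContinuousLinearMap.apply ℝ (ℝ × ℝ) ((1, 0) : ℝ × ℝ)) +
    (ContinuousLinearMap.snd ℝ ℝ ℝ).comp (ContinuousLinearMap.apply ℝ (ℝ × ℝ) ((0, 1) : ℝ × ℝ))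

/-- The shears `(1, 0)`, `(0, 1)`, `(1, 1)` span the traceless matrices. If `tr (S M) = 0` for all
of them then `M` is scalar, hence `±1` by its determinant. -/
theorem exists_planeTrace_shearMatrix_ne_zero {M : ℝ × ℝ →L[ℝ] ℝ × ℝ}
    (hM : planeArea (M (1, 0)) (M (0, 1)) = 1) (h1 : M ≠ 1) (h2 : M ≠ -1) :
    ∃ a b : ℤ, |a| ≤ 1 ∧ |b| ≤ 1 ∧ planeTrace ((shearMatrix a b).comp M) ≠ 0 := by
  by_contra! h
  have e1 := h 1 0 (by simp) (by simp)
  have e2 := h 0 1 (by simp) (by simp)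
  have e3 := h 1 1 (by simp) (by simp)
  simp [planeTrace, shearMatrix_apply] at e1 e2 e3
  have e4 : (M (1, 0)).1 = (M (0, 1)).2 := by linarith
  simp only [planeArea, e1, e2, e4, zero_mul, sub_zero] at hM
  have hs : ((M (0, 1)).2 - 1) * ((M (0, 1)).2 + 1) = 0 := by linear_combination hM
  rcases mul_eq_zero.mp hs with hs | hs
  · refine h1 ?_
    ext <;> simp [e1, e2, e4] <;> linarith
  · refine h2 ?_
    ext <;> simp [e1, e2, e4] <;> linarith

/-! ### Generic non-degeneracy -/

variable {U : Set ComplexTorus}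

/-- The maps all of whose points of period at most `k` are non-degenerate up to period `n`. -/
def nonDegUpTo (hUT : ∀ x, torusIncl x ∈ U) (n k : ℕ) : Set (HamU U) :=
  {F | ∀ d, d < k → ∀ x, (realMap hUT F.1)^[d + 1] x = x →
    torusJacIter hUT F.1 (d + 1) x ∉ degenerateSet n (d + 1)}

theorem isOpen_nonDegUpTo (hUo : IsOpen U) (hUT : ∀ x, torusIncl x ∈ U) (n k : ℕ) :
    IsOpen (nonDegUpTo hUT n k) := by
  have e : nonDegUpTo hUT n k = ⋂ d ∈ Finset.range k, {F : HamU U |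
      ∀ x, (realMap hUT F.1)^[d + 1] x = x →
        torusJacIter hUT F.1 (d + 1) x ∉ degenerateSet n (d + 1)} := by
    ext F
    simp [nonDegUpTo]
  rw [e]
  exact isOpen_biInter_finset fun d _ =>
    isOpen_setOf_forall_notMem hUo hUT (d + 1) (isClosed_degenerateSet n d)

theorem NDInHamU_eq_nonDegUpTo (hUT : ∀ x, torusIncl x ∈ U) (n : ℕ) :
    NDInHamU n U = nonDegUpTo hUT n n := by
  ext F
  rw [mem_NDInHamU_iff hUT]
  constructor
  · rintro ⟨-, h⟩ d hd x hx ⟨j, hj, h4⟩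
    rw [← torusJacIter_mul hUT F.1 hx] at h4
    refine (isNonDegenerate_realMap_iff hUT F.2 _ x).mp
      (h ((d + 1) * (j + 1)) (Nat.mul_pos d.succ_pos j.succ_pos) hj x ?_) h4
    rw [Function.iterate_mul]
    exact Function.iterate_fixed hx _
  · intro h
    refine ⟨isHamDiffeo_realMap hUT F.2, fun k hk hkn x hx => ?_⟩
    obtain ⟨d, rfl⟩ := Nat.exists_eq_add_of_le' hk
    rw [isNonDegenerate_realMap_iff hUT F.2]
    intro h4
    exact h d hkn x hx ⟨0, by simpa using hkn, by simpa using h4⟩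

/-- If the points of smaller period are non-degenerate, then a degenerate point has minimal
period. -/
theorem iterate_ne_of_mem_degenerateSet (hUT : ∀ x, torusIncl x ∈ U) {n d : ℕ} {F : HamU U}
    (hF : F ∈ nonDegUpTo hUT n d) {x : RealTorus} (hx : (realMap hUT F.1)^[d + 1] x = x)
    (hB : torusJacIter hUT F.1 (d + 1) x ∈ degenerateSet n (d + 1)) {j : ℕ} (hj : j < d) :
    (realMap hUT F.1)^[j + 1] x ≠ x := by
  intro hjx
  obtain ⟨i, hi, h4⟩ := hB
  set f := realMap hUT F.1
  have hper : Function.IsPeriodicPt f (d + 1) x := hx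
  obtain ⟨e, he⟩ := hper.minimalPeriod_dvd
  have hpos : 0 < Function.minimalPeriod f x := hper.minimalPeriod_pos d.succ_pos
  have hle : Function.minimalPeriod f x ≤ j + 1 :=
    Function.IsPeriodicPt.minimalPeriod_le j.succ_pos hjx
  have hmin : f^[Function.minimalPeriod f x] x = x := Function.iterate_minimalPeriod
  obtain ⟨m, hm⟩ := Nat.exists_eq_add_of_le' hpos
  rw [hm] at he hle hmin
  have he0 : 0 < e := Nat.pos_of_ne_zero fun h => by simp [h] at he
  -- With `d + 1 = (m + 1) * e`, a power of the derivative at period `d + 1` is a power of the one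
  -- at the minimal period `m + 1`. Degeneracy descends to that smaller period.
  rw [he, torusJacIter_mul hUT F.1 hmin, ← pow_mul] at h4
  obtain ⟨i', hi'⟩ := Nat.exists_eq_add_of_le' (Nat.mul_pos he0 i.succ_pos)
  rw [Nat.succ_eq_add_one] at hi'
  rw [hi'] at h4
  refine hF m (by omega) x hmin ⟨i', ?_, h4⟩
  rw [← hi', ← mul_assoc, ← he]
  exact hi

/-- Induction on the period with two perturbations per step, both kept in the open set where smaller
periods are already non-degenerate: the first removes derivatives `±1`, the second all other
degenerate ones. -/
theorem dense_nonDegUpTo (hUo : IsOpen U) (hUT : ∀ x, torusIncl x ∈ U) (n : ℕ) :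
    ∀ k, k ≤ n → Dense (nonDegUpTo hUT n k)
  | 0, _ => by
    have : nonDegUpTo hUT n 0 = univ := by ext F; simp [nonDegUpTo]
    rw [this]
    exact dense_univ
  | d + 1, hd => by
    rw [dense_iff_inter_open]
    intro V hVo hV
    obtain ⟨F₁, hF₁V, hF₁⟩ := (dense_nonDegUpTo hUo hUT n d (by omega)).inter_open_nonempty V hVo hV
    have hV₁o := hVo.inter (isOpen_nonDegUpTo hUo hUT n d)
    have hscalar : ∀ M ∈ ({1, -1} : Set (ℝ × ℝ →L[ℝ] ℝ × ℝ)), M ∈ degenerateSet n (d + 1) := by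
      rintro M (rfl | rfl)
      · exact ⟨0, by simpa using hd, by simp [planeTrace]; norm_num⟩
      · exact ⟨0, by simpa using hd, by simp [planeTrace]; norm_num⟩
    have hscalarc : IsClosed ({1, -1} : Set (ℝ × ℝ →L[ℝ] ℝ × ℝ)) := (toFinite _).isClosed
    -- The trace is stationary at `±1`, so the functional is the entry `(M (0, 1)).1`, which the
    -- shear `(0, 1)` changes at rate `±1`. The target is discrete, so any functional is locally
    -- constant on it.
    obtain ⟨F₂, ⟨hF₂V, hF₂⟩, hF₂'⟩ := exists_forall_torusJacIter_notMem hUT F₁ d hscalarc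
      (fun x hx hB => by
        refine ⟨fun j hj => iterate_ne_of_mem_degenerateSet hUT hF₁ hx (hscalar _ hB) hj,
          (ContinuousLinearMap.fst ℝ ℝ ℝ).comp
            (ContinuousLinearMap.apply ℝ (ℝ × ℝ) ((0, 1) : ℝ × ℝ)), ?_,
          0, 1, by simp, by simp, ?_⟩
        · have hfin : (({1, -1} : Set (ℝ × ℝ →L[ℝ] ℝ × ℝ)) \
              {torusJacIter hUT F₁.1 (d + 1) x}).Finite := toFinite _
          filter_upwards [hfin.isClosed.isOpen_compl.mem_nhds
            (show torusJacIter hUT F₁.1 (d + 1) x ∈ _ by simp)] with M hM hMB _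
          rw [show M = torusJacIter hUT F₁.1 (d + 1) x from by_contra fun h => hM ⟨hMB, h⟩]
        · rcases hB with hB | hB
          · rw [hB]; simp [shearMatrix_apply]
          · rw [mem_singleton_iff.mp hB]; simp [shearMatrix_apply])
      (hV₁o.mem_nhds ⟨hF₁V, hF₁⟩)
    -- With `±1` excluded, some shear changes the trace to first order.
    obtain ⟨F₃, ⟨hF₃V, hF₃⟩, hF₃'⟩ := exists_forall_torusJacIter_notMem hUT F₂ d
      (isClosed_degenerateSet n d)
      (fun x hx hB => by
        refine ⟨fun j hj => iterate_ne_of_mem_degenerateSet hUT hF₂ hx hB hj, planeTraceL,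
          eventually_planeTrace_eq n d _, ?_⟩
        have hne := hF₂' x hx
        simp only [mem_insert_iff, mem_singleton_iff, not_or] at hne
        exact exists_planeTrace_shearMatrix_ne_zero
          (by rw [planeArea_torusJacIter hUT F₂.2]; simp [planeArea]) hne.1 hne.2)
      (hV₁o.mem_nhds ⟨hF₂V, hF₂⟩)
    refine ⟨F₃, hF₃V, fun j hj x hx => ?_⟩
    rcases Nat.lt_succ_iff_lt_or_eq.mp hj with hj | rfl
    · exact hF₃ j hj x hx
    · exact hF₃' x hx

end

theorem proposition3p1 (U : Set ComplexTorus) (hUo : IsOpen U)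
    (hUT : ∀ x : RealTorus, torusIncl x ∈ U) (hUc : IsCompact (closure U))
    (n : ℕ) (hn : 1 ≤ n) :
    IsOpen (NDInHamU n U) ∧ Dense (NDInHamU n U) := by
  rw [NDInHamU_eq_nonDegUpTo hUT n]
  exact ⟨isOpen_nonDegUpTo hUo hUT n n, dense_nonDegUpTo hUo hUT n n le_rfl⟩
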